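/- Let $H$ be a complex Hilbert space and let $A:D(A)\subset H\to H$ be a (possibly unbounded) selfadjoint operator which is strictly positive, i.e. $\langle Au,u\rangle\ge c\|u\|^2$ on $D(A)$ for some $c>0$. Then $A$ has a spectral measure, i.e. a projection-valued measure $E_A$ on the Borel sets of $\sigma(A)\subset(0,\infty)$ with $A=\int_{\sigma(A)}s\,dE_A(s)$; for real continuous $\varphi$ on $\sigma(A)$ put $\varphi(A)=\int_{\sigma(A)}\varphi(s)\,dE_A(s)$, with domain $D(\varphi(A))=\{u\in H:\int_{\sigma(A)}|\varphi(s)|^2\,d\langle E_A(s)u,u\rangle<\infty\}$. Let $f:\sigma(A)\to[0,\infty)$ be continuous. Let $H^1=D(A^{1/2})$ with inner product $\langle A^{1/2}u,A^{1/2}v\rangle$, and let $\mathcal H=H^1\times H$ with $\|(u,v)\|_{\mathcal H}^2=\|A^{1/2}u\|^2+\|v\|^2$. Consider the linear operator $\mathbb A:D(\mathbb A)\subset\mathcal H\to\mathcal H$, $$\mathbb A(u,v)=(v,\,-(Au+f(A)v)),\qquad D(\mathbb A)=\{(u,v)\in\mathcal H:\ v\in H^1,\ Au+f(A)v\in H\},$$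 where $Au$ and $f(A)v$ are understood by duality as the functionals $w\mapsto\langle Aw,u\rangle$ and $w\mapsto\langle f(A)w,v\rangle$; that is, $Au+f(A)v=h\in H$ means $\langle Aw,u\rangle+\langle f(A)w,v\rangle=\langle w,h\rangle$ for all $w\in D(A)\cap D(f(A))$. Then $\mathbb A$ is the infinitesimal generator of a strongly continuous semigroup of contractions $S(t)=e^{t\mathbb A}$, $t\ge 0$, on $\mathcal H$. -/

import Mathlib

open MeasureTheory Filter Topology
open scoped NNReal

noncomputable section

/-! ### Spectral measures -/

/-- A spectral measure on `Ω` with values in the selfadjoint projections of `H`. Values on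
non-measurable sets are normalised to `0`, so that the map is determined by its restriction to the
`σ`-algebra. -/
structure SpectralMeasure (Ω : Type*) [MeasurableSpace Ω] (H : Type*) [NormedAddCommGroup H]
    [InnerProductSpace ℂ H] [CompleteSpace H] where
  toFun : Set Ω → (H →L[ℂ] H)
  not_measurable : ∀ ω, ¬ MeasurableSet ω → toFun ω = 0
  isStarProjection : ∀ ω, MeasurableSet ω → IsStarProjection (toFun ω)
  empty : toFun ∅ = 0
  univ : toFun Set.univ = 1
  inter : ∀ ω₁ ω₂, MeasurableSet ω₁ → MeasurableSet ω₂ →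
    toFun (ω₁ ∩ ω₂) = toFun ω₁ * toFun ω₂
  union : ∀ ω₁ ω₂, MeasurableSet ω₁ → MeasurableSet ω₂ → Disjoint ω₁ ω₂ →
    toFun (ω₁ ∪ ω₂) = toFun ω₁ + toFun ω₂
  hasSum_inner : ∀ (u v : H) (ω : ℕ → Set Ω), (∀ n, MeasurableSet (ω n)) →
    Pairwise (Function.onFun Disjoint ω) →
    HasSum (fun n => inner ℂ v (toFun (ω n) u)) (inner ℂ v (toFun (⋃ n, ω n) u))

namespace SpectralMeasure

variable {Ω : Type*} [MeasurableSpace Ω] {H : Type*} [NormedAddCommGroup H]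
  [InnerProductSpace ℂ H] [CompleteSpace H] (E : SpectralMeasure Ω H)

/-- The complex measure `μ_{u,v}(ω) = ⟨E(ω)u, v⟩` (the inner product being linear in its first
argument on paper, and in its second argument in Mathlib). -/
def complexMeasure (u v : H) : ComplexMeasure Ω where
  measureOf' ω := inner ℂ v (E.toFun ω u)
  empty' := by simp [E.empty]
  not_measurable' ω h := by simp [E.not_measurable ω h]
  m_iUnion' ω h₁ h₂ := E.hasSum_inner u v ω h₁ h₂

theorem complexMeasure_apply (u v : H) (ω : Set Ω) :
    E.complexMeasure u v ω = inner ℂ v (E.toFun ω u) := rfl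

theorem complexMeasure_add_left (u₁ u₂ v : H) :
    E.complexMeasure (u₁ + u₂) v = E.complexMeasure u₁ v + E.complexMeasure u₂ v := by
  ext ω _
  simp [complexMeasure_apply]

theorem complexMeasure_smul_left (c : ℂ) (u v : H) :
    E.complexMeasure (c • u) v = E.complexMeasure u (star c • v) := by
  ext ω _
  simp [complexMeasure_apply, mul_comm]

theorem complexMeasure_zero_left (v : H) : E.complexMeasure 0 v = 0 := by
  ext ω _
  simp [complexMeasure_apply]

theorem complexMeasure_self {ω : Set Ω} (u : H) :
    E.complexMeasure u u ω = ((‖E.toFun ω u‖ ^ 2 : ℝ) : ℂ) := by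
  by_cases hω : MeasurableSet ω
  · have h := E.isStarProjection ω hω
    have h1 : E.toFun ω u = E.toFun ω (E.toFun ω u) := by
      conv_lhs => rw [← h.isIdempotentElem.eq]
      rfl
    have h2 : ∀ x y, inner ℂ x (E.toFun ω y) = inner ℂ (E.toFun ω x) y := by
      intro x y
      have h3 : ContinuousLinearMap.adjoint (E.toFun ω) = E.toFun ω := h.isSelfAdjoint
      conv_lhs => rw [← h3]
      exact ContinuousLinearMap.adjoint_inner_right _ _ _
    rw [complexMeasure_apply, h1, h2, inner_self_eq_norm_sq_to_K, ← h1]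
    simp
  · simp [complexMeasure_apply, E.not_measurable ω hω]

theorem variation_self_add_le (u v : H) :
    (E.complexMeasure (u + v) (u + v)).variation ≤
      (2 : ℝ≥0) • ((E.complexMeasure u u).variation + (E.complexMeasure v v).variation) := by
  refine VectorMeasure.variation_le_of_forall_enorm_le fun ω _ => ?_
  have h : ‖E.complexMeasure (u + v) (u + v) ω‖₊ ≤
      2 * (‖E.complexMeasure u u ω‖₊ + ‖E.complexMeasure v v ω‖₊) := by
    rw [← NNReal.coe_le_coe]
    simp only [complexMeasure_self, NNReal.coe_mul, NNReal.coe_add, coe_nnnorm, NNReal.coe_ofNat,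
      Complex.norm_real, Real.norm_eq_abs, abs_pow, abs_norm, map_add]
    have h1 := norm_add_le (E.toFun ω u) (E.toFun ω v)
    have h2 := pow_le_pow_left₀ (norm_nonneg _) h1 2
    nlinarith [sq_nonneg (‖E.toFun ω u‖ - ‖E.toFun ω v‖)]
  calc ‖E.complexMeasure (u + v) (u + v) ω‖ₑ
      ≤ (2 : ℝ≥0) * (‖E.complexMeasure u u ω‖ₑ + ‖E.complexMeasure v v ω‖ₑ) := by
        simp only [enorm_eq_nnnorm]
        exact_mod_cast h
    _ ≤ _ := by
        rw [Measure.smul_apply, Measure.nnreal_smul_coe_apply, Measure.add_apply]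
        gcongr <;> exact VectorMeasure.enorm_measure_le_variation _ _

theorem integrable_self_smul {φ : Ω → ℝ} (c : ℂ) (u : H)
    (h : (E.complexMeasure u u).Integrable φ) :
    (E.complexMeasure (c • u) (c • u)).Integrable φ := by
  have h1 : E.complexMeasure (c • u) (c • u) = ((‖c‖ ^ 2 : ℝ)) • E.complexMeasure u u := by
    ext ω _
    rw [smul_apply, complexMeasure_self, complexMeasure_self]
    simp [norm_smul, mul_pow]
  rw [h1]
  exact h.smul_vectorMeasure _

/-- The graph of the operator `∫ φ dE`: the pairs `(u, w)` such that `∫ |φ|² dμ_{u,u} < ∞` and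
`⟨w, v⟩ = ∫ φ dμ_{u,v}` for all `v`. For measurable `φ` with `∫ |φ|² dμ_{u,u} < ∞`, exactly one
such `w` exists (the functional is bounded by `‖φ‖_{L²(μ_{u,u})} ‖v‖`), so the domain is
`{u : ∫ |φ|² dμ_{u,u} < ∞}`. -/
def integralGraph (φ : Ω → ℝ) : Submodule ℂ (H × H) where
  carrier := {p | (E.complexMeasure p.1 p.1).Integrable (fun s => φ s ^ 2) ∧
    ∀ v : H, (E.complexMeasure p.1 v).Integrable φ ∧
      inner ℂ v p.2 = (E.complexMeasure p.1 v).integral φ (ContinuousLinearMap.lsmul ℝ ℝ)}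
  add_mem' := by
    rintro ⟨u₁, w₁⟩ ⟨u₂, w₂⟩ ⟨h₁, k₁⟩ ⟨h₂, k₂⟩
    refine ⟨?_, fun v => ?_⟩
    · exact Integrable.mono_measure
        (Integrable.smul_measure_nnreal (integrable_add_measure.2 ⟨h₁, h₂⟩))
        (E.variation_self_add_le u₁ u₂)
    · simp only [Prod.fst_add, Prod.snd_add, complexMeasure_add_left]
      refine ⟨(k₁ v).1.add_vectorMeasure (k₂ v).1, ?_⟩
      rw [VectorMeasure.integral_add_vectorMeasure (k₁ v).1 (k₂ v).1, inner_add_right,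
        ← (k₁ v).2, ← (k₂ v).2]
  zero_mem' := by
    simp [complexMeasure_zero_left]
  smul_mem' := by
    rintro c ⟨u, w⟩ ⟨h, k⟩
    refine ⟨E.integrable_self_smul c u h, fun v => ?_⟩
    simp only [Prod.smul_fst, Prod.smul_snd, complexMeasure_smul_left]
    refine ⟨(k _).1, ?_⟩
    rw [← (k _).2, inner_smul_right, inner_smul_left]
    simp

theorem integralGraph_single_valued (φ : Ω → ℝ) (p : H × H) (hp : p ∈ E.integralGraph φ)
    (h : p.1 = 0) : p.2 = 0 := by
  have h1 := (hp.2 p.2).2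
  rw [h, complexMeasure_zero_left, VectorMeasure.integral_zero_vectorMeasure] at h1
  exact inner_self_eq_zero.1 h1

/-- The (unbounded) operator `∫ φ dE` for a real-valued `φ`. -/
def integral (φ : Ω → ℝ) : H →ₗ.[ℂ] H := (E.integralGraph φ).toLinearPMap

theorem graph_integral (φ : Ω → ℝ) : (E.integral φ).graph = E.integralGraph φ :=
  Submodule.toLinearPMap_graph_eq _ (E.integralGraph_single_valued φ)

theorem variation_self_apply (u : H) {ω : Set Ω} (hω : MeasurableSet ω) :
    (E.complexMeasure u u).variation ω = ENNReal.ofReal (‖E.toFun ω u‖ ^ 2) := by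
  have h0 : ∀ ω, ‖E.complexMeasure u u ω‖ₑ = ENNReal.ofReal (‖E.toFun ω u‖ ^ 2) := by
    intro ω
    rw [complexMeasure_self, ← ofReal_norm]
    simp
  apply le_antisymm
  · let m : Measure Ω := Measure.ofMeasurable
      (fun ω _ => ENNReal.ofReal (‖E.toFun ω u‖ ^ 2)) (by simp [E.empty]) (by
        intro g hg hd
        have h1 := E.hasSum_inner u u g hg hd
        simp only [← complexMeasure_apply, complexMeasure_self] at h1
        have h2 : HasSum (fun n => ‖E.toFun (g n) u‖ ^ 2) (‖E.toFun (⋃ n, g n) u‖ ^ 2) :=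
          Complex.hasSum_ofReal.1 h1
        rw [← h2.tsum_eq, ENNReal.ofReal_tsum_of_nonneg (fun _ => by positivity) h2.summable])
    have hm : ∀ ω, MeasurableSet ω → m ω = ENNReal.ofReal (‖E.toFun ω u‖ ^ 2) :=
      fun ω hω => Measure.ofMeasurable_apply ω hω
    rw [← hm ω hω]
    exact VectorMeasure.variation_le_of_forall_enorm_le
      (fun s hs => by rw [hm s hs, h0]) ω
  · rw [← h0]
    exact VectorMeasure.enorm_measure_le_variation _ _

instance isFiniteMeasure_variation_self (u : H) :
    IsFiniteMeasure (E.complexMeasure u u).variation :=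
  ⟨by rw [variation_self_apply E u MeasurableSet.univ]; exact ENNReal.ofReal_lt_top⟩

theorem integral_self_eq {φ : Ω → ℝ} (u : H) (h : (E.complexMeasure u u).Integrable φ) :
    (E.complexMeasure u u).integral φ (ContinuousLinearMap.lsmul ℝ ℝ) =
      ((∫ s, φ s ∂(E.complexMeasure u u).variation : ℝ) : ℂ) := by
  revert φ
  refine Integrable.induction _ ?_ ?_ ?_ ?_
  · intro c s hs _
    rw [MeasureTheory.integral_indicator hs, MeasureTheory.setIntegral_const,
      VectorMeasure.integral_indicator hs]
    have : IsFiniteMeasure ((E.complexMeasure u u).restrict s).variation := by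
      rw [VectorMeasure.variation_restrict hs]; infer_instance
    rw [VectorMeasure.integral_const, VectorMeasure.restrict_apply _ hs MeasurableSet.univ,
      Measure.real, E.variation_self_apply u hs, Set.univ_inter, complexMeasure_self,
      ENNReal.toReal_ofReal (by positivity)]
    simp [mul_comm]
  · intro f g _ hf hg h1 h2
    have h3 := VectorMeasure.integral_add (B := ContinuousLinearMap.lsmul ℝ ℝ) hf hg
    rw [h1, h2] at h3
    rw [MeasureTheory.integral_add' hf hg, Complex.ofReal_add, ← h3]
  · refine isClosed_eq ?_ ?_
    · exact VectorMeasure.continuous_integral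
    · exact Complex.continuous_ofReal.comp MeasureTheory.continuous_integral
  · intro f g hfg _ h1
    have h3 := VectorMeasure.integral_congr_ae (B := ContinuousLinearMap.lsmul ℝ ℝ)
      (μ := E.complexMeasure u u) hfg
    rw [← MeasureTheory.integral_congr_ae hfg, ← h1, ← h3]

/-- The operator `∫ φ dE` is injective if `φ > 0`. -/
theorem integral_injective {φ : Ω → ℝ} (hφ : ∀ s, 0 < φ s) :
    Function.Injective (E.integral φ).toFun := by
  rw [← LinearMap.ker_eq_bot, LinearMap.ker_eq_bot']
  intro u hu
  have h : ((u : H), (0 : H)) ∈ E.integralGraph φ := by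
    rw [← graph_integral, LinearPMap.mem_graph_iff]
    exact ⟨u, rfl, hu⟩
  obtain ⟨h1, h2⟩ := h.2 (u : H)
  simp only [inner_zero_right] at h2
  rw [E.integral_self_eq _ h1] at h2
  have h3 : ∫ s, φ s ∂(E.complexMeasure (u : H) u).variation = 0 := by exact_mod_cast h2.symm
  rw [MeasureTheory.integral_eq_zero_iff_of_nonneg (fun s => (hφ s).le) h1] at h3
  have h4 : (E.complexMeasure (u : H) u).variation Set.univ = 0 := by
    have h5 := MeasureTheory.ae_iff.1 h3
    convert! h5
    ext s
    simp [(hφ s).ne']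
  rw [E.variation_self_apply _ MeasurableSet.univ, E.univ] at h4
  have h6 : ‖(u : H)‖ ^ 2 ≤ 0 := by simpa using h4
  have h7 : ‖(u : H)‖ = 0 := by nlinarith [norm_nonneg (u : H)]
  exact Subtype.ext (norm_eq_zero.1 h7)

end SpectralMeasure

/-! ### Strictly positive selfadjoint operators -/

/-- The resolvent set of an unbounded operator: `z - A : D(A) → H` is bijective with bounded
inverse. -/
def LinearPMap.unboundedResolventSet {H : Type*} [NormedAddCommGroup H] [InnerProductSpace ℂ H]
    (A : H →ₗ.[ℂ] H) : Set ℂ :=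
  {z | ∃ R : H →L[ℂ] H, (∀ x : H, ∃ u : A.domain, R x = u ∧ z • (u : H) - A u = x) ∧
    ∀ u : A.domain, R (z • (u : H) - A u) = u}

/-- A strictly positive selfadjoint (possibly unbounded) operator in `H`. -/
structure StrictlyPositiveOperator (H : Type*) [NormedAddCommGroup H] [InnerProductSpace ℂ H]
    [CompleteSpace H] where
  op : H →ₗ.[ℂ] H
  isSelfAdjoint : IsSelfAdjoint op
  strictlyPositive : ∃ c : ℝ, 0 < c ∧
    ∀ u : op.domain, c * ‖(u : H)‖ ^ 2 ≤ (inner ℂ (u : H) (op u)).re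

namespace StrictlyPositiveOperator

variable {H : Type*} [NormedAddCommGroup H] [InnerProductSpace ℂ H] [CompleteSpace H]

/-- The spectrum `σ(A)`, as a subset of the real line (the spectrum of a selfadjoint operator is
real). -/
def spectrum (A : StrictlyPositiveOperator H) : Set ℝ := {s | (s : ℂ) ∉ A.op.unboundedResolventSet}

theorem pos_of_mem_spectrum (A : StrictlyPositiveOperator H) {s : ℝ} (hs : s ∈ A.spectrum) :
    0 < s := by
  by_contra! hs0
  apply hs
  obtain ⟨c, hc, hA⟩ := A.strictlyPositive
  let T : A.op.domain →ₗ[ℂ] H := (s : ℂ) • A.op.domain.subtype - A.op.toFun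
  have hT : ∀ u : A.op.domain, T u = (s : ℂ) • (u : H) - A.op u := fun u => rfl
  have hb : ∀ u : A.op.domain, c * ‖(u : H)‖ ≤ ‖T u‖ := by
    intro u
    have h1 : (inner ℂ (u : H) (T u)).re ≤ - (c * ‖(u : H)‖ ^ 2) := by
      have h2 : inner ℂ (u : H) (u : H) = ((‖(u : H)‖ ^ 2 : ℝ) : ℂ) := by
        rw [inner_self_eq_norm_sq_to_K]; simp
      rw [hT, inner_sub_right, inner_smul_right, h2, ← Complex.ofReal_mul, Complex.sub_re,
        Complex.ofReal_re]
      nlinarith [hA u, sq_nonneg ‖(u : H)‖]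
    have h3 := (Complex.abs_re_le_norm _).trans (norm_inner_le_norm (𝕜 := ℂ) (u : H) (T u))
    have h4 := neg_le_abs (inner ℂ (u : H) (T u)).re
    rcases (norm_nonneg (u : H)).eq_or_lt with h0 | h0
    · rw [← h0]; simp
    · nlinarith
  have hinj : Function.Injective T := by
    rw [← LinearMap.ker_eq_bot, LinearMap.ker_eq_bot']
    intro u hu
    have h1 := hb u
    rw [hu, norm_zero] at h1
    have h2 : ‖(u : H)‖ = 0 := by nlinarith [norm_nonneg (u : H)]
    exact Subtype.ext (norm_eq_zero.1 h2)
  have hclosed : IsClosed (LinearMap.range T : Set H) := by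
    refine IsSeqClosed.isClosed fun y y₀ hy hlim => ?_
    choose u hu using hy
    have hcau : CauchySeq (fun n => (u n : H)) := by
      rw [Metric.cauchySeq_iff]
      intro ε hε
      obtain ⟨N, hN⟩ := Metric.cauchySeq_iff.1 hlim.cauchySeq (c * ε) (by positivity)
      refine ⟨N, fun m hm n hn => ?_⟩
      have h1 := hN m hm n hn
      have h2 := hb (u m - u n)
      rw [map_sub, hu, hu, ← dist_eq_norm, Submodule.coe_sub, ← dist_eq_norm] at h2
      exact lt_of_mul_lt_mul_left (h2.trans_lt h1) hc.le
    obtain ⟨u₀, hu₀⟩ := cauchySeq_tendsto_of_complete hcau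
    have hg : (u₀, (s : ℂ) • u₀ - y₀) ∈ A.op.graph := by
      refine A.isSelfAdjoint.isClosed.mem_of_tendsto
        (hu₀.prodMk_nhds ((hu₀.const_smul (s : ℂ)).sub hlim)) (Eventually.of_forall fun n => ?_)
      simp only [SetLike.mem_coe, LinearPMap.mem_graph_iff]
      refine ⟨u n, rfl, ?_⟩
      rw [← hu n, hT]
      abel
    obtain ⟨w, hw1, hw2⟩ := (LinearPMap.mem_graph_iff _).1 hg
    refine ⟨w, ?_⟩
    simp only at hw1 hw2
    rw [hT, hw1, hw2]
    abel
  have hsurj : Function.Surjective T := by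
    rw [← LinearMap.range_eq_top, ← hclosed.submodule_topologicalClosure_eq,
      Submodule.topologicalClosure_eq_top_iff, Submodule.eq_bot_iff]
    intro w hw
    have h1 : ∀ u : A.op.domain, inner ℂ ((s : ℂ) • w) (u : H) = inner ℂ w (A.op u) := by
      intro u
      have h2 := (Submodule.mem_orthogonal' _ _).1 hw (T u) ⟨u, rfl⟩
      rw [hT, inner_sub_right, inner_smul_right, sub_eq_zero] at h2
      rw [inner_smul_left, ← h2]
      simp
    have hdense := A.isSelfAdjoint.dense_domain
    have hdom : w ∈ A.op.adjoint.domain :=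
      LinearPMap.mem_adjoint_domain_of_exists _ ⟨_, h1⟩
    have happ : A.op.adjoint ⟨w, hdom⟩ = (s : ℂ) • w :=
      LinearPMap.adjoint_apply_eq hdense _ h1
    have hg : (w, (s : ℂ) • w) ∈ A.op.adjoint.graph :=
      (LinearPMap.mem_graph_iff _).2 ⟨⟨w, hdom⟩, rfl, happ⟩
    rw [LinearPMap.isSelfAdjoint_def.1 A.isSelfAdjoint] at hg
    obtain ⟨v, hv1, hv2⟩ := (LinearPMap.mem_graph_iff _).1 hg
    simp only at hv1 hv2
    have h3 := hb v
    rw [hT, hv2, hv1, sub_self, norm_zero] at h3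
    exact norm_eq_zero.1 (by nlinarith [norm_nonneg w])
  let e := LinearEquiv.ofBijective T ⟨hinj, hsurj⟩
  have he : ∀ x, T (e.symm x) = x := fun x => e.apply_symm_apply x
  let R : H →L[ℂ] H := LinearMap.mkContinuous
    (A.op.domain.subtype ∘ₗ (e.symm : H →ₗ[ℂ] A.op.domain)) c⁻¹ (by
      intro x
      have h1 := hb (e.symm x)
      rw [he] at h1
      rw [inv_mul_eq_div, le_div_iff₀' hc]
      exact h1)
  exact ⟨R, fun x => ⟨e.symm x, rfl, he x⟩, fun u => congrArg Subtype.val (e.symm_apply_apply u)⟩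

/-- `E` is the spectral measure of `A`: it is a spectral measure on the Borel sets of `σ(A)` and
`A = ∫ s dE(s)`, as unbounded operators. -/
def IsSpectralMeasure (A : StrictlyPositiveOperator H) (E : SpectralMeasure A.spectrum H) : Prop :=
  A.op = E.integral (fun s => (s : ℝ))

variable {A : StrictlyPositiveOperator H}

/-- The square root `A^{1/2} = ∫ √s dE(s)`. -/
def sqrtOp (E : SpectralMeasure A.spectrum H) : H →ₗ.[ℂ] H :=
  E.integral (fun s => √(s : ℝ))

/-- The space `H¹ = D(A^{1/2})`, with inner product `⟨A^{1/2} u, A^{1/2} v⟩`. -/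
def H1 (E : SpectralMeasure A.spectrum H) : Type _ := (sqrtOp E).domain

instance (E : SpectralMeasure A.spectrum H) : AddCommGroup (H1 E) :=
  inferInstanceAs (AddCommGroup (sqrtOp E).domain)

instance (E : SpectralMeasure A.spectrum H) : Module ℂ (H1 E) :=
  inferInstanceAs (Module ℂ (sqrtOp E).domain)

/-- The inclusion `H¹ → H`. -/
def H1.incl (E : SpectralMeasure A.spectrum H) : H1 E →ₗ[ℂ] H := (sqrtOp E).domain.subtype

/-- The map `A^{1/2} : H¹ → H`. -/
def H1.sqrt (E : SpectralMeasure A.spectrum H) : H1 E →ₗ[ℂ] H := (sqrtOp E).toFun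

theorem H1.sqrt_injective (E : SpectralMeasure A.spectrum H) : Function.Injective (H1.sqrt E) :=
  E.integral_injective fun s => Real.sqrt_pos.2 (A.pos_of_mem_spectrum s.2)

/-- The norm `‖u‖₁ = ‖A^{1/2} u‖`. -/
instance (E : SpectralMeasure A.spectrum H) : NormedAddCommGroup (H1 E) :=
  NormedAddCommGroup.induced (H1 E) H (H1.sqrt E) (H1.sqrt_injective E)

instance (E : SpectralMeasure A.spectrum H) : InnerProductSpace ℂ (H1 E) where
  norm_smul_le c u := by
    change ‖H1.sqrt E (c • u)‖ ≤ ‖c‖ * ‖H1.sqrt E u‖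
    rw [map_smul, norm_smul]
  inner u v := inner ℂ (H1.sqrt E u) (H1.sqrt E v)
  norm_sq_eq_re_inner u := norm_sq_eq_re_inner (𝕜 := ℂ) (H1.sqrt E u)
  conj_inner_symm _ _ := inner_conj_symm _ _
  add_left u v w := by rw [map_add, inner_add_left]
  smul_left u v c := by rw [map_smul, inner_smul_left]

/-- The phase space `H¹ × H` with the norm `‖(u, v)‖² = ‖u‖₁² + ‖v‖²`. -/
abbrev PhaseSpace (E : SpectralMeasure A.spectrum H) : Type _ := WithLp 2 (H1 E × H)

/-- The operator `f(A) = ∫ f(s) dE(s)`. -/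
def damping (E : SpectralMeasure A.spectrum H) (f : C(A.spectrum, ℝ≥0)) : H →ₗ.[ℂ] H :=
  E.integral (fun s => (f s : ℝ))

/-- `A u + f(A) v = h` with `h ∈ H`, where `A u` and `f(A) v` are understood by duality, as the
functionals `w ↦ ⟨A w, u⟩` and `w ↦ ⟨f(A) w, v⟩`, on the space `D(A) ∩ D(f(A))` on which both are
defined, and `h` is identified with `w ↦ ⟨w, h⟩`. -/
def DualSumEq (E : SpectralMeasure A.spectrum H) (f : C(A.spectrum, ℝ≥0)) (u v h : H) : Prop :=
  ∀ (w : H) (hw : w ∈ A.op.domain) (hw' : w ∈ (damping E f).domain),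
    inner ℂ u (A.op ⟨w, hw⟩) + inner ℂ v (damping E f ⟨w, hw'⟩) = inner ℂ h w

/-- The graph of the operator `𝔸(u, v) = (v, -(A u + f(A) v))` in `H¹ × H` with domain
`{(u, v) ∈ H¹ × H : v ∈ H¹, A u + f(A) v ∈ H}`: it consists of the pairs `((u, v), (u', v'))` with
`u' = v` (so `v ∈ H¹`) and `A u + f(A) v = -v' ∈ H`. -/
def waveGraph (E : SpectralMeasure A.spectrum H) (f : C(A.spectrum, ℝ≥0)) :
    Submodule ℂ (PhaseSpace E × PhaseSpace E) where
  carrier := {p | H1.incl E p.2.fst = p.1.snd ∧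
    DualSumEq E f (H1.incl E p.1.fst) p.1.snd (-p.2.snd)}
  add_mem' := by
    rintro p q ⟨h₁, k₁⟩ ⟨h₂, k₂⟩
    refine ⟨?_, fun w hw hw' => ?_⟩
    · simp [h₁, h₂]
    · have a := k₁ w hw hw'
      have b := k₂ w hw hw'
      simp only [Prod.fst_add, Prod.snd_add, WithLp.add_fst, WithLp.add_snd, map_add, neg_add,
        inner_add_left]
      rw [← a, ← b]
      ring
  zero_mem' := by
    refine ⟨by simp, fun w hw hw' => by simp⟩
  smul_mem' := by
    rintro c p ⟨h, k⟩
    refine ⟨?_, fun w hw hw' => ?_⟩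
    · simp [h]
    · have a := k w hw hw'
      simp only [Prod.smul_fst, Prod.smul_snd, WithLp.smul_fst, WithLp.smul_snd, map_smul,
        ← smul_neg, inner_smul_left]
      rw [← a]
      ring

end StrictlyPositiveOperator

/-! ### Semigroups -/

/-- A strongly continuous semigroup of contractions on a normed space. -/
structure ContractionSemigroup (X : Type*) [NormedAddCommGroup X] [NormedSpace ℂ X] where
  toFun : ℝ≥0 → X →L[ℂ] X
  map_zero : toFun 0 = 1
  map_add : ∀ s t, toFun (s + t) = toFun s * toFun t
  tendsto_zero : ∀ x, Tendsto (fun t => toFun t x) (𝓝[>] 0) (𝓝 x)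
  norm_le_one : ∀ t, ‖toFun t‖ ≤ 1

namespace ContractionSemigroup

variable {X : Type*} [NormedAddCommGroup X] [NormedSpace ℂ X] (S : ContractionSemigroup X)

/-- The graph of the infinitesimal generator: the pairs `(x, y)` with
`y = lim_{t → 0+} (S(t) x - x) / t`. -/
def generatorGraph : Submodule ℂ (X × X) where
  carrier := {p | Tendsto (fun t : ℝ≥0 => ((t : ℝ) : ℂ)⁻¹ • (S.toFun t p.1 - p.1)) (𝓝[>] 0)
    (𝓝 p.2)}
  add_mem' := by
    intro p q hp hq
    refine (hp.add hq).congr fun t => ?_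
    simp only [Prod.fst_add, _root_.map_add, ← smul_add]
    congr 1
    abel
  zero_mem' := by
    simp
  smul_mem' := by
    intro c p hp
    refine (hp.const_smul c).congr fun t => ?_
    simp only [Prod.smul_fst, map_smul, ← smul_sub]
    rw [smul_comm]

/-- The infinitesimal generator, with its natural domain. -/
def generator : X →ₗ.[ℂ] X := S.generatorGraph.toLinearPMap

theorem graph_generator : S.generator.graph = S.generatorGraph := by
  refine Submodule.toLinearPMap_graph_eq _ fun p hp h => ?_
  change Tendsto _ _ _ at hp
  simp only [h, _root_.map_zero, sub_zero, smul_zero] at hp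
  exact tendsto_nhds_unique hp tendsto_const_nhds

end ContractionSemigroup

end

/-!
The inverse `T = A⁻¹` is bounded and selfadjoint. The Riesz representation theorem turns
`φ ↦ ⟨φ(T)u, u⟩` into a measure `μ_u` on `σ(T)`, and `φ ↦ φ(T)u` extends to an isometry
`L²(μ_u) → H` whose values at indicator functions are the spectral projections of `T`. As `T` is
injective they do not charge `0`, so they can be transported to `σ(A)` by `s ↦ s⁻¹`.

For the semigroup, let `ωₙ` be the part of the spectrum where `s` and `f s` are at most `n`. Cut
down to `ωₙ` and with `u` replaced by `A^{1/2} u`, the wave operator becomes the bounded dissipative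
operator `(a, b) ↦ (A^{1/2} b, -A^{1/2} a - f(A) b)`, whose exponentials are contractions. They are
compatible with the spectral projections as `n` varies and therefore converge strongly to a
contraction semigroup. Testing on the ranges of the projections `E(ωₙ)` shows that its generator is
the operator of the theorem.
-/

noncomputable section

/-! ### Bounded measurable functions -/

/-- Measurable bounded real functions: the integrands for which `∫ g dE` is a bounded operator. -/
structure IsBoundedMeasurable {Ω : Type*} [MeasurableSpace Ω] (g : Ω → ℝ) : Prop where
  measurable : Measurable g
  bounded : ∃ C : ℝ, ∀ x, ‖g x‖ ≤ C

namespace IsBoundedMeasurable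

variable {Ω : Type*} [MeasurableSpace Ω] {g h : Ω → ℝ}

theorem exists_nonneg_bound (hg : IsBoundedMeasurable g) : ∃ C, 0 ≤ C ∧ ∀ x, ‖g x‖ ≤ C := by
  obtain ⟨C, hC⟩ := hg.bounded
  exact ⟨|C|, abs_nonneg C, fun x => (hC x).trans (le_abs_self C)⟩

theorem mul (hg : IsBoundedMeasurable g) (hh : IsBoundedMeasurable h) :
    IsBoundedMeasurable (g * h) := by
  obtain ⟨C, hC⟩ := hg.bounded
  obtain ⟨D, hD⟩ := hh.bounded
  exact ⟨hg.measurable.mul hh.measurable, C * D, fun x => norm_mul_le_of_le (hC x) (hD x)⟩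

theorem add (hg : IsBoundedMeasurable g) (hh : IsBoundedMeasurable h) :
    IsBoundedMeasurable (g + h) := by
  obtain ⟨C, hC⟩ := hg.bounded
  obtain ⟨D, hD⟩ := hh.bounded
  exact ⟨hg.measurable.add hh.measurable, C + D, fun x => norm_add_le_of_le (hC x) (hD x)⟩

theorem indicator_of_bound {φ : Ω → ℝ} (hφ : Measurable φ) {s : Set Ω} (hs : MeasurableSet s)
    {C : ℝ} (hC : ∀ x ∈ s, ‖φ x‖ ≤ C) : IsBoundedMeasurable (s.indicator φ) := by
  refine ⟨hφ.indicator hs, |C|, fun x => ?_⟩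
  by_cases hx : x ∈ s
  · rw [Set.indicator_of_mem hx]
    exact (hC x hx).trans (le_abs_self C)
  · rw [Set.indicator_of_notMem hx, norm_zero]
    exact abs_nonneg C

theorem indicator_const (c : ℝ) {s : Set Ω} (hs : MeasurableSet s) :
    IsBoundedMeasurable (s.indicator fun _ => c) :=
  indicator_of_bound measurable_const hs fun _ _ => le_rfl

theorem comp {Ω' : Type*} [MeasurableSpace Ω'] (hg : IsBoundedMeasurable g) {j : Ω' → Ω}
    (hj : Measurable j) : IsBoundedMeasurable (g ∘ j) := by
  obtain ⟨C, hC⟩ := hg.bounded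
  exact ⟨hg.measurable.comp hj, C, fun s => hC (j s)⟩

theorem integrable (hg : IsBoundedMeasurable g) (μ : Measure Ω) [IsFiniteMeasure μ] :
    Integrable g μ := by
  obtain ⟨C, hC⟩ := hg.bounded
  exact .of_bound hg.measurable.aestronglyMeasurable C (ae_of_all _ hC)

theorem induction {P : (Ω → ℝ) → Prop}
    (indicator : ∀ (c : ℝ) (s : Set Ω), MeasurableSet s → P (s.indicator fun _ => c))
    (add : ∀ f g, IsBoundedMeasurable f → IsBoundedMeasurable g → P f → P g → P (f + g))
    (lim : ∀ (F : ℕ → Ω → ℝ) (f : Ω → ℝ) (C : ℝ), (∀ n, Measurable (F n)) →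
      (∀ n x, ‖F n x‖ ≤ C) → (∀ x, Tendsto (fun n => F n x) atTop (𝓝 (f x))) →
      (∀ n, P (F n)) → P f)
    (hg : IsBoundedMeasurable g) : P g := by
  classical
  have simpleFunc (φ : SimpleFunc Ω ℝ) : IsBoundedMeasurable φ ∧ P φ := by
    induction φ using SimpleFunc.induction with
    | const c hs =>
      rw [SimpleFunc.coe_piecewise, SimpleFunc.coe_const, SimpleFunc.coe_const,
        Function.const_zero, Set.piecewise_eq_indicator]
      exact ⟨indicator_const c hs, indicator c _ hs⟩
    | add _ hφ hψ =>
      rw [SimpleFunc.coe_add]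
      exact ⟨hφ.1.add hψ.1, add _ _ hφ.1 hψ.1 hφ.2 hψ.2⟩
  obtain ⟨C, hC0, hC⟩ := hg.exists_nonneg_bound
  have hm := hg.measurable.stronglyMeasurable
  exact lim (fun n => hm.approxBounded C n) g C (fun n => SimpleFunc.measurable _)
    (fun n x => hm.norm_approxBounded_le hC0 n x)
    (fun x => hm.tendsto_approxBounded_of_norm_le (hC x)) fun n => (simpleFunc _).2

end IsBoundedMeasurable

/-- An increasing sequence of measurable sets exhausting the space, along which unbounded
integrands are truncated. -/
structure IsExhaustion {Ω : Type*} [MeasurableSpace Ω] (ω : ℕ → Set Ω) : Prop where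
  measurableSet : ∀ n, MeasurableSet (ω n)
  mono : Monotone ω
  iUnion : ⋃ n, ω n = Set.univ

namespace IsExhaustion

variable {Ω : Type*} [MeasurableSpace Ω] {ω : ℕ → Set Ω}

theorem eventually_mem (hω : IsExhaustion ω) (x : Ω) : ∀ᶠ n in atTop, x ∈ ω n := by
  obtain ⟨N, hN⟩ := Set.mem_iUnion.1 (hω.iUnion ▸ Set.mem_univ x)
  filter_upwards [eventually_ge_atTop N] with n hn using hω.mono hn hN

theorem aecover (hω : IsExhaustion ω) (μ : Measure Ω) : AECover μ atTop ω :=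
  ⟨ae_of_all _ hω.eventually_mem, hω.measurableSet⟩

theorem tendsto_indicator (hω : IsExhaustion ω) (φ : Ω → ℝ) (x : Ω) :
    Tendsto (fun n => (ω n).indicator φ x) atTop (𝓝 (φ x)) :=
  tendsto_const_nhds.congr' <| (hω.eventually_mem x).mono fun _ hx =>
    (Set.indicator_of_mem hx φ).symm

end IsExhaustion

section NormLE

variable {Ω : Type*} [MeasurableSpace Ω] {φ : Ω → ℝ} (hφ : Measurable φ)
include hφ

theorem isExhaustion_norm_le : IsExhaustion fun n : ℕ => {x | ‖φ x‖ ≤ n} where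
  measurableSet _ := measurableSet_le hφ.norm measurable_const
  mono _ _ hmn _ hx := le_trans (a := ‖φ _‖) hx (Nat.cast_le.2 hmn)
  iUnion := Set.eq_univ_of_forall fun x => Set.mem_iUnion.2 (exists_nat_ge ‖φ x‖)

theorem isBoundedMeasurable_indicator_norm_le (n : ℕ) :
    IsBoundedMeasurable ({x | ‖φ x‖ ≤ n}.indicator φ) :=
  .indicator_of_bound hφ ((isExhaustion_norm_le hφ).measurableSet n) fun _ hx => hx

end NormLE

/-! ### The spectral projections and their scalar measures -/

theorem lintegral_le_lintegral_sq_add {Ω : Type*} [MeasurableSpace Ω] {κ μ ν : Measure Ω}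
    (h : ∀ (c : ℝ≥0) (s : Set Ω), c * κ s ≤ c ^ 2 * μ s + ν s) (φ : Ω → ℝ≥0) :
    ∫⁻ x, φ x ∂κ ≤ ∫⁻ x, (φ x : ENNReal) ^ 2 ∂μ + ν Set.univ := by
  rw [lintegral_eq_nnreal]
  refine iSup₂_le fun ψ hψ => ?_
  calc (ψ.map ((↑) : ℝ≥0 → ENNReal)).lintegral κ
      ≤ ((ψ ^ 2).map ((↑) : ℝ≥0 → ENNReal)).lintegral μ + ν Set.univ := by
        rw [SimpleFunc.map_lintegral, show ψ ^ 2 = ψ.map (fun x => x ^ 2) from rfl,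
          SimpleFunc.map_map, SimpleFunc.map_lintegral,
          ← SimpleFunc.sum_range_measure_preimage_singleton ψ, ← Finset.sum_add_distrib]
        refine Finset.sum_le_sum fun c _ => ?_
        simpa using h c (ψ ⁻¹' {c})
    _ ≤ ∫⁻ x, (φ x : ENNReal) ^ 2 ∂μ + ν Set.univ := by
        rw [← SimpleFunc.lintegral_eq_lintegral]
        gcongr with x
        have hψx : ψ x ≤ φ x := by exact_mod_cast hψ x
        simp only [SimpleFunc.coe_map, Function.comp_apply, SimpleFunc.coe_pow, Pi.pow_apply]
        exact_mod_cast pow_le_pow_left₀ zero_le hψx 2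

theorem inner_self_eq_ofReal_iff {H : Type*} [NormedAddCommGroup H] [InnerProductSpace ℂ H]
    {x : H} {r : ℝ} : inner ℂ x x = (r : ℂ) ↔ ‖x‖ ^ 2 = r := by
  rw [inner_self_eq_norm_sq_to_K, ← Complex.ofReal_inj, Complex.ofReal_pow]
  rfl

namespace SpectralMeasure

variable {Ω : Type*} [MeasurableSpace Ω] {H : Type*} [NormedAddCommGroup H]
  [InnerProductSpace ℂ H] [CompleteSpace H] (E : SpectralMeasure Ω H)

theorem isSelfAdjoint_toFun (ω : Set Ω) : IsSelfAdjoint (E.toFun ω) := by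
  by_cases hω : MeasurableSet ω
  · exact (E.isStarProjection ω hω).isSelfAdjoint
  · rw [E.not_measurable ω hω]
    exact .zero _

theorem inner_toFun_left (ω : Set Ω) (x y : H) :
    inner ℂ (E.toFun ω x) y = inner ℂ x (E.toFun ω y) :=
  (E.isSelfAdjoint_toFun ω).isSymmetric x y

theorem toFun_compl {s : Set Ω} (hs : MeasurableSet s) : E.toFun sᶜ = 1 - E.toFun s := by
  rw [eq_sub_iff_add_eq', ← E.union s sᶜ hs hs.compl disjoint_compl_right, Set.union_compl_self,
    E.univ]

theorem toFun_toFun {ω₁ ω₂ : Set Ω} (h₁ : MeasurableSet ω₁) (h₂ : MeasurableSet ω₂) (u : H) :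
    E.toFun ω₁ (E.toFun ω₂ u) = E.toFun (ω₁ ∩ ω₂) u := by
  rw [E.inter _ _ h₁ h₂]
  rfl

theorem inner_toFun_toFun (ω : Set Ω) (x y : H) :
    inner ℂ (E.toFun ω x) (E.toFun ω y) = inner ℂ x (E.toFun ω y) := by
  by_cases hω : MeasurableSet ω
  · rw [inner_toFun_left, toFun_toFun E hω hω, Set.inter_self]
  · simp [E.not_measurable ω hω]

theorem norm_toFun_le (ω : Set Ω) (x : H) : ‖E.toFun ω x‖ ≤ ‖x‖ := by
  by_cases hω : MeasurableSet ω
  · have hE := (E.toFun ω).le_of_opNorm_le (E.isStarProjection ω hω).norm_le x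
    rwa [one_mul] at hE
  · simp [E.not_measurable ω hω]

theorem complexMeasure_smul_smul (c : ℂ) (u : H) :
    E.complexMeasure (c • u) (c • u) = ((‖c‖ ^ 2 : ℝ) : ℂ) • E.complexMeasure u u := by
  ext ω _
  rw [complexMeasure_self, smul_apply, complexMeasure_self]
  simp [norm_smul, mul_pow]

theorem complexMeasure_smul (c : ℂ) (u v : H) :
    E.complexMeasure (c • u) v = c • E.complexMeasure u v := by
  ext ω _
  simp [complexMeasure_apply]

theorem complexMeasure_toFun_right {s : Set Ω} (hs : MeasurableSet s) (u v : H) :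
    E.complexMeasure u (E.toFun s v) = (E.complexMeasure u v).restrict s := by
  ext t ht
  rw [VectorMeasure.restrict_apply _ hs ht, complexMeasure_apply, complexMeasure_apply,
    inner_toFun_left, E.toFun_toFun hs ht, Set.inter_comm]

theorem variation_le (u v : H) : (E.complexMeasure u v).variation ≤
    (E.complexMeasure u u).variation + (E.complexMeasure v v).variation := by
  refine VectorMeasure.variation_le_of_forall_enorm_le fun ω hω => ?_
  rw [Measure.add_apply, variation_self_apply E u hω, variation_self_apply E v hω,
    ← ENNReal.ofReal_add (by positivity) (by positivity), ← ofReal_norm, complexMeasure_apply,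
    ← inner_toFun_toFun]
  refine ENNReal.ofReal_le_ofReal ((norm_inner_le_norm _ _).trans ?_)
  linarith [two_mul_le_add_sq ‖E.toFun ω v‖ ‖E.toFun ω u‖,
    mul_nonneg (norm_nonneg (E.toFun ω v)) (norm_nonneg (E.toFun ω u))]

instance isFiniteMeasure_variation (u v : H) :
    IsFiniteMeasure (E.complexMeasure u v).variation :=
  isFiniteMeasure_of_le _ (E.variation_le u v)

theorem mul_variation_le (u v : H) (c : ℝ≥0) (ω : Set Ω) :
    c * (E.complexMeasure u v).variation ω ≤
      c ^ 2 * (E.complexMeasure u u).variation ω + (E.complexMeasure v v).variation ω := by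
  have hcu := E.variation_le (((c : ℝ) : ℂ) • u) v ω
  rw [Measure.add_apply, complexMeasure_smul_smul, complexMeasure_smul,
    VectorMeasure.variation_smul, VectorMeasure.variation_smul, Measure.smul_apply,
    Measure.smul_apply] at hcu
  simpa [ENNReal.smul_def] using hcu

theorem variation_self_real (u : H) {ω : Set Ω} (hω : MeasurableSet ω) :
    (E.complexMeasure u u).variation.real ω = ‖E.toFun ω u‖ ^ 2 := by
  rw [Measure.real, variation_self_apply E u hω, ENNReal.toReal_ofReal (by positivity)]

theorem variation_real_univ_le (u v : H) :
    (E.complexMeasure u v).variation.real Set.univ ≤ 2 * ‖u‖ * ‖v‖ := by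
  set x := (E.complexMeasure u v).variation.real Set.univ
  have hx : 0 ≤ x := measureReal_nonneg
  have quadratic (c : ℝ) : 0 ≤ ‖u‖ ^ 2 * (c * c) + -x * c + ‖v‖ ^ 2 := by
    rcases le_total c 0 with hc | hc
    · nlinarith [mul_nonneg hx (neg_nonneg.2 hc), mul_nonneg (sq_nonneg ‖u‖) (mul_self_nonneg c),
        sq_nonneg ‖v‖]
    · lift c to ℝ≥0 using hc
      have hcx := ENNReal.toReal_mono (by finiteness) (E.mul_variation_le u v c Set.univ)
      rw [ENNReal.toReal_add (by finiteness) (by finiteness), ENNReal.toReal_mul,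
        ENNReal.toReal_mul, ← Measure.real, ← Measure.real, ← Measure.real,
        E.variation_self_real u .univ, E.variation_self_real v .univ, E.univ] at hcx
      simp only [ENNReal.toReal_pow, ENNReal.coe_toReal, one_apply_eq_self] at hcx
      linarith
  refine le_of_sq_le_sq ?_ (by positivity)
  have hdiscrim := discrim_le_zero quadratic
  rw [discrim] at hdiscrim
  linarith

/-! ### The bounded functional calculus -/

/-- The sesquilinear form `∫ φ dμ_{u,v}`, where `μ_{u,v} = ⟨E(·)u, v⟩`; it is linear in `u` and
antilinear in `v`. -/
abbrev form (φ : Ω → ℝ) (u v : H) : ℂ :=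
  (E.complexMeasure u v).integral φ (ContinuousLinearMap.lsmul ℝ ℝ)

variable {E} {g h : Ω → ℝ}

theorem form_indicator_const (c : ℝ) {s : Set Ω} (hs : MeasurableSet s) (u v : H) :
    E.form (s.indicator fun _ => c) u v = c * inner ℂ v (E.toFun s u) := by
  have : IsFiniteMeasure ((E.complexMeasure u v).restrict s).variation := by
    rw [VectorMeasure.variation_restrict hs]; infer_instance
  rw [form, VectorMeasure.integral_indicator hs,
    VectorMeasure.integral_const, VectorMeasure.restrict_apply _ hs MeasurableSet.univ,
    Set.univ_inter, complexMeasure_apply]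
  simp

theorem form_add (hg : IsBoundedMeasurable g) (hh : IsBoundedMeasurable h) (u v : H) :
    E.form (g + h) u v = E.form g u v + E.form h u v :=
  VectorMeasure.integral_add (hg.integrable _) (hh.integrable _)

theorem tendsto_form {F : ℕ → Ω → ℝ} {f : Ω → ℝ} {C : ℝ} (hF : ∀ n, Measurable (F n))
    (hC : ∀ n x, ‖F n x‖ ≤ C) (hf : ∀ x, Tendsto (fun n => F n x) atTop (𝓝 (f x))) (u v : H) :
    Tendsto (fun n => E.form (F n) u v) atTop (𝓝 (E.form f u v)) :=
  VectorMeasure.tendsto_integral_of_dominated_convergence (fun _ => C)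
    (fun n => (hF n).aestronglyMeasurable) (integrable_const C)
    (fun n => ae_of_all _ (hC n)) (ae_of_all _ hf)

theorem form_add_left (hg : IsBoundedMeasurable g) (u₁ u₂ v : H) :
    E.form g (u₁ + u₂) v = E.form g u₁ v + E.form g u₂ v := by
  rw [form, complexMeasure_add_left]
  exact VectorMeasure.integral_add_vectorMeasure (hg.integrable _) (hg.integrable _)

theorem form_smul_left (hg : IsBoundedMeasurable g) (c : ℂ) (u v : H) :
    E.form g (c • u) v = c * E.form g u v := by
  refine hg.induction (P := fun g => E.form g (c • u) v = c * E.form g u v) ?indicator ?add ?lim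
  case indicator =>
    intro r s hs
    rw [form_indicator_const r hs, form_indicator_const r hs, map_smul, inner_smul_right]
    ring
  case add =>
    intro f g hf hg hfc hgc
    rw [form_add hf hg, form_add hf hg, hfc, hgc, mul_add]
  case lim =>
    intro F f C hF hC hf hFc
    refine tendsto_nhds_unique (tendsto_form hF hC hf _ _) ?_
    simp_rw [hFc]
    exact (tendsto_form hF hC hf _ _).const_mul c

theorem form_swap (hg : IsBoundedMeasurable g) (u v : H) :
    E.form g v u = star (E.form g u v) := by
  refine hg.induction (P := fun g => E.form g v u = star (E.form g u v)) ?indicator ?add ?lim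
  case indicator =>
    intro r s hs
    rw [form_indicator_const r hs, form_indicator_const r hs, ← inner_toFun_left,
      ← inner_conj_symm]
    simp
  case add =>
    intro f g hf hg hfs hgs
    rw [form_add hf hg, form_add hf hg, hfs, hgs, star_add]
  case lim =>
    intro F f C hF hC hf hFs
    refine tendsto_nhds_unique (tendsto_form hF hC hf _ _) ?_
    simp_rw [hFs]
    exact (continuous_star.tendsto _).comp (tendsto_form hF hC hf _ _)

theorem norm_form_le {C : ℝ} (hC0 : 0 ≤ C) (hC : ∀ x, ‖g x‖ ≤ C) (u v : H) :
    ‖E.form g u v‖ ≤ C * (2 * ‖u‖ * ‖v‖) :=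
  calc ‖E.form g u v‖
      ≤ C * ‖(ContinuousLinearMap.lsmul ℝ ℝ : ℝ →L[ℝ] ℂ →L[ℝ] ℂ)‖ *
          (E.complexMeasure u v).variation.real Set.univ :=
        VectorMeasure.norm_integral_le_of_norm_le_const (ae_of_all _ hC)
    _ ≤ C * 1 * (2 * ‖u‖ * ‖v‖) := by
        gcongr
        exacts [ContinuousLinearMap.opNorm_lsmul_le, E.variation_real_univ_le u v]
    _ = C * (2 * ‖u‖ * ‖v‖) := by rw [mul_one]

theorem exists_inner_eq_form (E : SpectralMeasure Ω H) (hg : IsBoundedMeasurable g) :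
    ∃ T : H →L[ℂ] H, ∀ u v, inner ℂ v (T u) = E.form g u v := by
  obtain ⟨C, hC0, hC⟩ := hg.exists_nonneg_bound
  let B : H →ₗ⋆[ℂ] H →ₗ[ℂ] ℂ :=
    LinearMap.mk₂'ₛₗ (starRingEnd ℂ) (RingHom.id ℂ) (fun v u => E.form g u v)
      (fun v₁ v₂ u => by
        rw [form_swap hg, form_add_left hg, star_add, ← form_swap hg, ← form_swap hg])
      (fun c v u => by
        rw [form_swap hg, form_smul_left hg, star_mul', ← form_swap hg, smul_eq_mul]; rfl)
      (fun v u₁ u₂ => form_add_left hg _ _ _)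
      (fun c v u => form_smul_left hg _ _ _)
  have hB (v u : H) : ‖B v u‖ ≤ 2 * C * ‖v‖ * ‖u‖ :=
    (norm_form_le (E := E) hC0 hC u v).trans_eq (by ring)
  refine ⟨ContinuousLinearMap.adjoint
    (InnerProductSpace.continuousLinearMapOfBilin (B.mkContinuous₂ (2 * C) hB)), fun u v => ?_⟩
  rw [ContinuousLinearMap.adjoint_inner_right, InnerProductSpace.continuousLinearMapOfBilin_apply]
  rfl

open Classical in
/-- The bounded operator `∫ g dE` for bounded measurable `g`, and `0` for other `g`. -/
def boundedIntegral (E : SpectralMeasure Ω H) (g : Ω → ℝ) : H →L[ℂ] H :=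
  if hg : IsBoundedMeasurable g then (E.exists_inner_eq_form hg).choose else 0

theorem inner_boundedIntegral (hg : IsBoundedMeasurable g) (u v : H) :
    inner ℂ v (E.boundedIntegral g u) = E.form g u v := by
  rw [boundedIntegral, dif_pos hg]
  exact (E.exists_inner_eq_form hg).choose_spec u v

theorem inner_boundedIntegral_left (hg : IsBoundedMeasurable g) (u v : H) :
    inner ℂ (E.boundedIntegral g v) u = inner ℂ v (E.boundedIntegral g u) := by
  rw [inner_boundedIntegral hg, ← inner_conj_symm, inner_boundedIntegral hg, form_swap hg]
  exact star_star _

theorem inner_boundedIntegral_self (hg : IsBoundedMeasurable g) (u : H) :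
    inner ℂ u (E.boundedIntegral g u) = ((∫ s, g s ∂(E.complexMeasure u u).variation : ℝ) : ℂ) := by
  rw [inner_boundedIntegral hg]
  exact E.integral_self_eq u (hg.integrable _)

theorem boundedIntegral_indicator_one {s : Set Ω} (hs : MeasurableSet s) :
    E.boundedIntegral (s.indicator fun _ => 1) = E.toFun s := by
  ext u
  refine ext_inner_left ℂ fun v => ?_
  rw [inner_boundedIntegral (.indicator_const 1 hs), form_indicator_const 1 hs, Complex.ofReal_one,
    one_mul]

theorem form_toFun_right {s : Set Ω} (hs : MeasurableSet s) (φ : Ω → ℝ) (u v : H) :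
    E.form φ u (E.toFun s v) = E.form (s.indicator φ) u v := by
  rw [form, form, E.complexMeasure_toFun_right hs, VectorMeasure.integral_indicator hs]

theorem form_boundedIntegral_left (hg : IsBoundedMeasurable g) (hh : IsBoundedMeasurable h)
    (u v : H) : E.form g (E.boundedIntegral h u) v = E.form (g * h) u v := by
  refine hg.induction (P := fun g => E.form g (E.boundedIntegral h u) v = E.form (g * h) u v)
    ?indicator ?add ?lim
  case indicator =>
    intro r s hs
    have indicator_mul : (s.indicator fun _ => r) * h = r • s.indicator h := by
      ext x
      by_cases hx : x ∈ s <;> simp [hx]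
    rw [form_indicator_const r hs, ← inner_toFun_left, inner_boundedIntegral hh,
      form_toFun_right hs, indicator_mul, form, form, VectorMeasure.integral_smul,
      Complex.real_smul]
  case add =>
    intro f g hf hg hfh hgh
    rw [form_add hf hg, hfh, hgh, ← form_add (hf.mul hh) (hg.mul hh), add_mul]
  case lim =>
    intro F f C hF hC hf hFh
    obtain ⟨D, hD⟩ := hh.bounded
    refine tendsto_nhds_unique (tendsto_form hF hC hf _ _) ?_
    simp_rw [hFh]
    exact tendsto_form (fun n => (hF n).mul hh.measurable)
      (fun n x => norm_mul_le_of_le (hC n x) (hD x)) (fun x => (hf x).mul_const _) _ _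

theorem boundedIntegral_boundedIntegral (hg : IsBoundedMeasurable g) (hh : IsBoundedMeasurable h)
    (u : H) : E.boundedIntegral g (E.boundedIntegral h u) = E.boundedIntegral (g * h) u := by
  refine ext_inner_left ℂ fun v => ?_
  rw [inner_boundedIntegral hg, inner_boundedIntegral (hg.mul hh), form_boundedIntegral_left hg hh]

theorem toFun_boundedIntegral {s : Set Ω} (hs : MeasurableSet s) (hg : IsBoundedMeasurable g)
    (u : H) : E.toFun s (E.boundedIntegral g u) = E.boundedIntegral (s.indicator g) u := by
  rw [← boundedIntegral_indicator_one hs,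
    boundedIntegral_boundedIntegral (.indicator_const 1 hs) hg]
  congr 2
  ext x
  by_cases hx : x ∈ s <;> simp [hx]

theorem boundedIntegral_toFun {s : Set Ω} (hs : MeasurableSet s) (hg : IsBoundedMeasurable g)
    (u : H) : E.boundedIntegral g (E.toFun s u) = E.boundedIntegral (s.indicator g) u := by
  rw [← toFun_boundedIntegral hs hg, ← boundedIntegral_indicator_one hs,
    boundedIntegral_boundedIntegral hg (.indicator_const 1 hs),
    boundedIntegral_boundedIntegral (.indicator_const 1 hs) hg, mul_comm]

theorem toFun_boundedIntegral_comm {s : Set Ω} (hs : MeasurableSet s)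
    (hg : IsBoundedMeasurable g) (u : H) :
    E.toFun s (E.boundedIntegral g u) = E.boundedIntegral g (E.toFun s u) := by
  rw [toFun_boundedIntegral hs hg, boundedIntegral_toFun hs hg]

theorem boundedIntegral_indicator_toFun {s t : Set Ω} (hs : MeasurableSet s) (hst : s ⊆ t)
    {φ : Ω → ℝ} (hφ : IsBoundedMeasurable (t.indicator φ)) (u : H) :
    E.boundedIntegral (t.indicator φ) (E.toFun s u) = E.boundedIntegral (s.indicator φ) u := by
  rw [boundedIntegral_toFun hs hφ, Set.indicator_indicator, Set.inter_eq_left.2 hst]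

theorem norm_boundedIntegral_sq (hg : IsBoundedMeasurable g) (u : H) :
    ‖E.boundedIntegral g u‖ ^ 2 = ∫ s, g s ^ 2 ∂(E.complexMeasure u u).variation := by
  rw [← inner_self_eq_ofReal_iff, inner_boundedIntegral_left hg,
    boundedIntegral_boundedIntegral hg hg, inner_boundedIntegral_self (hg.mul hg)]
  simp only [Pi.mul_apply, pow_two]

/-! ### The unbounded functional calculus by truncation -/

theorem integrable_of_sq {φ : Ω → ℝ} (hφ : Measurable φ) {u : H}
    (hsq : (E.complexMeasure u u).Integrable fun s => φ s ^ 2) (v : H) :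
    (E.complexMeasure u v).Integrable φ := by
  have hsq_lt : ∫⁻ s, (‖φ s‖₊ : ENNReal) ^ 2 ∂(E.complexMeasure u u).variation < ⊤ := by
    simpa [HasFiniteIntegral, enorm_eq_nnnorm] using Integrable.hasFiniteIntegral hsq
  exact ⟨hφ.aestronglyMeasurable,
    (lintegral_le_lintegral_sq_add (E.mul_variation_le u v) fun s => ‖φ s‖₊).trans_lt
      (ENNReal.add_lt_top.2 ⟨hsq_lt, measure_lt_top _ _⟩)⟩

section Truncation

variable {ω : ℕ → Set Ω} (hω : IsExhaustion ω)
include hω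

theorem tendsto_inner_toFun (E : SpectralMeasure Ω H) (u v : H) :
    Tendsto (fun n => inner ℂ v (E.toFun (ω n) u)) atTop (𝓝 (inner ℂ v u)) := by
  have hform := tendsto_form (E := E) (C := ‖(1 : ℝ)‖)
    (fun n => measurable_const.indicator (hω.measurableSet n))
    (fun n x => norm_indicator_le_norm_self (fun _ => (1 : ℝ)) x)
    (fun x => hω.tendsto_indicator (fun _ => 1) x) u v
  rw [← Set.indicator_univ fun _ => (1 : ℝ), form_indicator_const 1 .univ, E.univ] at hform
  simpa [form_indicator_const 1 (hω.measurableSet _)] using hform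

theorem tendsto_toFun (E : SpectralMeasure Ω H) (u : H) :
    Tendsto (fun n => E.toFun (ω n) u) atTop (𝓝 u) := by
  have norm_sq (n : ℕ) :
      ‖E.toFun (ω n) u - u‖ ^ 2 = (inner ℂ u u).re - (inner ℂ u (E.toFun (ω n) u)).re := by
    have hsub := norm_sub_sq (𝕜 := ℂ) (E.toFun (ω n) u) u
    rw [inner_toFun_left, RCLike.re_to_complex] at hsub
    rw [hsub, ← inner_toFun_toFun, inner_self_eq_ofReal_iff.2 rfl, inner_self_eq_ofReal_iff.2 rfl,
      Complex.ofReal_re, Complex.ofReal_re]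
    ring
  have hre := ((Complex.continuous_re.tendsto _).comp (tendsto_inner_toFun hω E u u)).const_sub
    (inner ℂ u u).re
  rw [sub_self] at hre
  have hsqrt := (Real.continuous_sqrt.tendsto 0).comp (hre.congr fun n => (norm_sq n).symm)
  rw [tendsto_iff_norm_sub_tendsto_zero]
  simpa only [Function.comp_def, Real.sqrt_sq (norm_nonneg _), Real.sqrt_zero] using hsqrt

theorem eq_of_forall_toFun_eq (E : SpectralMeasure Ω H) {u v : H}
    (huv : ∀ n, E.toFun (ω n) u = E.toFun (ω n) v) : u = v := by
  refine tendsto_nhds_unique (tendsto_toFun hω E u) ?_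
  simp_rw [huv]
  exact tendsto_toFun hω E v

variable {φ : Ω → ℝ} (hφ : Measurable φ) (hb : ∀ n, IsBoundedMeasurable ((ω n).indicator φ))
include hφ hb

theorem integrable_sq_of_forall_boundedIntegral_eq {u w : H}
    (h : ∀ n, E.boundedIntegral ((ω n).indicator φ) u = E.toFun (ω n) w) :
    (E.complexMeasure u u).Integrable fun s => φ s ^ 2 := by
  refine (hω.aecover _).integrable_of_lintegral_enorm_bounded (‖w‖ ^ 2)
    (hφ.pow_const 2).aestronglyMeasurable (.of_forall fun n => ?_)
  set μ := (E.complexMeasure u u).variation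
  have indicator_sq : (ω n).indicator (fun s => φ s ^ 2) = fun s => (ω n).indicator φ s ^ 2 := by
    ext s
    by_cases hs : s ∈ ω n <;> simp [hs]
  have hint : IntegrableOn (fun s => φ s ^ 2) (ω n) μ := by
    rw [← integrable_indicator_iff (hω.measurableSet n), indicator_sq]
    simp_rw [pow_two]
    exact ((hb n).mul (hb n)).integrable μ
  calc ∫⁻ s in ω n, ‖φ s ^ 2‖ₑ ∂μ = ENNReal.ofReal (∫ s in ω n, φ s ^ 2 ∂μ) := by
        rw [ofReal_integral_eq_lintegral_ofReal hint (ae_of_all _ fun s => sq_nonneg _)]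
        exact lintegral_congr fun s => Real.enorm_of_nonneg (sq_nonneg _)
    _ = ENNReal.ofReal (‖E.toFun (ω n) w‖ ^ 2) := by
        rw [← h n, norm_boundedIntegral_sq (hb n), ← integral_indicator (hω.measurableSet n),
          indicator_sq]
    _ ≤ ENNReal.ofReal (‖w‖ ^ 2) := by
        gcongr
        exact E.norm_toFun_le _ _

theorem mem_integralGraph_iff (u w : H) :
    (u, w) ∈ E.integralGraph φ ↔
      ∀ n, E.boundedIntegral ((ω n).indicator φ) u = E.toFun (ω n) w := by
  refine ⟨fun h n => ext_inner_left ℂ fun v => ?_, fun h => ?_⟩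
  · rw [inner_boundedIntegral (hb n), ← form_toFun_right (hω.measurableSet n), ← inner_toFun_left]
    exact (h.2 _).2.symm
  have hint := integrable_of_sq hφ (integrable_sq_of_forall_boundedIntegral_eq hω hφ hb h)
  refine ⟨integrable_sq_of_forall_boundedIntegral_eq hω hφ hb h, fun v => ⟨hint v, ?_⟩⟩
  have hform : Tendsto (fun n => E.form ((ω n).indicator φ) u v) atTop (𝓝 (E.form φ u v)) :=
    VectorMeasure.tendsto_integral_of_dominated_convergence (fun s => ‖φ s‖)
      (fun n => (hb n).measurable.aestronglyMeasurable) (hint v).norm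
      (fun n => ae_of_all _ fun s => norm_indicator_le_norm_self _ _)
      (ae_of_all _ fun s => hω.tendsto_indicator φ s)
  refine tendsto_nhds_unique (tendsto_inner_toFun hω E w v) ?_
  simp_rw [← h, inner_boundedIntegral (hb _)]
  exact hform

theorem toFun_mem_integralGraph (n : ℕ) (x : H) :
    (E.toFun (ω n) x, E.boundedIntegral ((ω n).indicator φ) x) ∈ E.integralGraph φ := by
  refine (mem_integralGraph_iff hω hφ hb _ _).2 fun m => ?_
  rw [boundedIntegral_toFun (hω.measurableSet n) (hb m),
    toFun_boundedIntegral (hω.measurableSet m) (hb n), Set.indicator_indicator,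
    Set.indicator_indicator, Set.inter_comm]

theorem forall_inner_add_inner_eq_iff {ψ : Ω → ℝ} (hψ : Measurable ψ)
    (hbψ : ∀ n, IsBoundedMeasurable ((ω n).indicator ψ)) (u v k : H) :
    (∀ w p q, (w, p) ∈ E.integralGraph φ → (w, q) ∈ E.integralGraph ψ →
      inner ℂ u p + inner ℂ v q = inner ℂ k w) ↔
    ∀ n, E.boundedIntegral ((ω n).indicator φ) u + E.boundedIntegral ((ω n).indicator ψ) v =
      E.toFun (ω n) k := by
  constructor
  · intro h n
    refine ext_inner_right ℂ fun x => ?_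
    rw [inner_add_left, inner_boundedIntegral_left (hb n), inner_boundedIntegral_left (hbψ n),
      inner_toFun_left]
    exact h _ _ _ (toFun_mem_integralGraph hω hφ hb n x) (toFun_mem_integralGraph hω hψ hbψ n x)
  · intro h w p q hp hq
    refine tendsto_nhds_unique
      ((tendsto_inner_toFun hω E p u).add (tendsto_inner_toFun hω E q v))
      ((tendsto_inner_toFun hω E w k).congr fun n => ?_)
    rw [← inner_toFun_left, ← h n, inner_add_left, inner_boundedIntegral_left (hb n),
      inner_boundedIntegral_left (hbψ n), (mem_integralGraph_iff hω hφ hb w p).1 hp n,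
      (mem_integralGraph_iff hω hψ hbψ w q).1 hq n]

end Truncation

theorem mem_integralGraph_iff_of_mul_eq_one {φ : Ω → ℝ} (hφ : Measurable φ)
    (hg : IsBoundedMeasurable g) (hφg : φ * g = 1) (u w : H) :
    (u, w) ∈ E.integralGraph φ ↔ E.boundedIntegral g w = u := by
  have hν := isExhaustion_norm_le hφ
  have hb := isBoundedMeasurable_indicator_norm_le hφ
  have indicator_mul (n : ℕ) : {x | ‖φ x‖ ≤ n}.indicator φ * g =
      {x | ‖φ x‖ ≤ n}.indicator fun _ => 1 := by
    ext x
    by_cases hx : x ∈ {x | ‖φ x‖ ≤ n}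
    · rw [Pi.mul_apply, Set.indicator_of_mem hx, Set.indicator_of_mem hx]
      exact congrFun hφg x
    · rw [Pi.mul_apply, Set.indicator_of_notMem hx, Set.indicator_of_notMem hx, zero_mul]
  rw [mem_integralGraph_iff hν hφ hb]
  constructor
  · intro h
    refine eq_of_forall_toFun_eq hν E fun n => ?_
    rw [toFun_boundedIntegral_comm (hν.measurableSet n) hg, ← h n,
      boundedIntegral_boundedIntegral hg (hb n), mul_comm, indicator_mul,
      boundedIntegral_indicator_one (hν.measurableSet n)]
  · rintro rfl n
    rw [boundedIntegral_boundedIntegral (hb n) hg, indicator_mul,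
      boundedIntegral_indicator_one (hν.measurableSet n)]

end SpectralMeasure

/-! ### The spectral measure of a bounded selfadjoint operator -/

section InnerSelf

variable {H : Type*} [NormedAddCommGroup H] [InnerProductSpace ℂ H]

theorem eq_of_forall_inner_self_eq {S T : H →L[ℂ] H}
    (h : ∀ u, inner ℂ u (S u) = inner ℂ u (T u)) : S = T := by
  refine ContinuousLinearMap.coe_inj.1 ((ext_inner_map _ _).1 fun u => ?_)
  rw [ContinuousLinearMap.coe_coe, ContinuousLinearMap.coe_coe, ← inner_conj_symm, h,
    inner_conj_symm]

theorem hasSum_inner_of_forall_hasSum_inner_self {ι : Type*} {Q : ι → H →L[ℂ] H} {S : H →L[ℂ] H}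
    (h : ∀ u, HasSum (fun i => inner ℂ (Q i u) u) (inner ℂ (S u) u)) (u v : H) :
    HasSum (fun i => inner ℂ (Q i u) v) (inner ℂ (S u) v) := by
  have polarization (T : H →L[ℂ] H) := inner_map_polarization' (T : H →ₗ[ℂ] H) u v
  simp only [ContinuousLinearMap.coe_coe] at polarization
  simp_rw [polarization]
  exact ((((h _).sub (h _)).sub ((h _).mul_left _)).add ((h _).mul_left _)).div_const 4

theorem norm_eq_norm_of_inner_self_eq_ofReal {F : Type*} [NormedAddCommGroup F]
    [InnerProductSpace ℝ F] {x : H} {y : F} (h : inner ℂ x x = ((inner ℝ y y : ℝ) : ℂ)) :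
    ‖x‖ = ‖y‖ := by
  rw [real_inner_self_eq_norm_sq, inner_self_eq_ofReal_iff] at h
  exact (pow_left_inj₀ (norm_nonneg _) (norm_nonneg _) two_ne_zero).1 h

end InnerSelf

theorem isBoundedMeasurable_coe_of_isCompact {K : Set ℝ} (hK : IsCompact K) :
    IsBoundedMeasurable fun t : K => (t : ℝ) := by
  obtain ⟨C, hC⟩ := hK.isBounded.exists_norm_le
  exact ⟨measurable_subtype_coe, C, fun t => hC t t.2⟩

theorem hasSum_measureReal_iUnion {Ω : Type*} [MeasurableSpace Ω] (μ : Measure Ω)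
    [IsFiniteMeasure μ] {ω : ℕ → Set Ω} (hω : ∀ n, MeasurableSet (ω n))
    (hd : Pairwise (Function.onFun Disjoint ω)) :
    HasSum (fun n => μ.real (ω n)) (μ.real (⋃ n, ω n)) := by
  have tsum_eq := measure_iUnion (μ := μ) hd hω
  rw [Measure.real, tsum_eq, ENNReal.tsum_toReal_eq fun n => measure_ne_top μ (ω n)]
  exact ENNReal.hasSum_toReal (tsum_eq ▸ measure_ne_top μ _)

theorem exists_continuous_tendsto_eLpNorm_sub {X F : Type*} [TopologicalSpace X] [NormalSpace X]
    [MeasurableSpace X] [BorelSpace X] [NormedAddCommGroup F] [NormedSpace ℝ F] {p : ENNReal}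
    (hp : p ≠ ⊤) {ν : Measure X} [ν.WeaklyRegular] {f : X → F} (hf : MemLp f p ν) :
    ∃ φ : ℕ → C(X, F), Tendsto (fun n => eLpNorm (f - (φ n : X → F)) p ν) atTop (𝓝 0) := by
  choose φ hφ _ using fun n : ℕ => hf.exists_boundedContinuous_eLpNorm_sub_le hp
    (ε := (n : ENNReal)⁻¹) (ENNReal.inv_ne_zero.2 (ENNReal.natCast_ne_top n))
  exact ⟨fun n => (φ n).toContinuousMap, tendsto_of_tendsto_of_tendsto_of_le_of_le
    tendsto_const_nhds ENNReal.tendsto_inv_nat_nhds_zero (fun _ => zero_le) hφ⟩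

section BoundedSelfAdjoint

variable {H : Type*} [NormedAddCommGroup H] [InnerProductSpace ℂ H] [CompleteSpace H]
  {T : H →L[ℂ] H} (hT : IsSelfAdjoint T)

theorem inner_cfcHom_left (φ : C(spectrum ℝ T, ℝ)) (u v : H) :
    inner ℂ (cfcHom hT φ u) v = inner ℂ u (cfcHom hT φ v) :=
  IsSelfAdjoint.isSymmetric (cfcHom_predicate hT φ) u v

theorem inner_cfcHom_cfcHom (φ ψ : C(spectrum ℝ T, ℝ)) (u : H) :
    inner ℂ (cfcHom hT φ u) (cfcHom hT ψ u) = inner ℂ u (cfcHom hT (φ * ψ) u) := by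
  rw [inner_cfcHom_left, map_mul]
  rfl

theorem ofReal_re_inner_cfcHom_self (φ : C(spectrum ℝ T, ℝ)) (u : H) :
    ((inner ℂ u (cfcHom hT φ u)).re : ℂ) = inner ℂ u (cfcHom hT φ u) :=
  Complex.conj_eq_iff_re.1 (by rw [inner_conj_symm, inner_cfcHom_left])

theorem re_inner_cfcHom_self_nonneg {φ : C(spectrum ℝ T, ℝ)} (hφ : ∀ t, 0 ≤ φ t) (u : H) :
    0 ≤ (inner ℂ u (cfcHom hT φ u)).re := by
  let ψ : C(spectrum ℝ T, ℝ) := ⟨fun t => √(φ t), by fun_prop⟩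
  have sq_eq : φ = ψ * ψ := ContinuousMap.ext fun t => (Real.mul_self_sqrt (hφ t)).symm
  rw [sq_eq, ← inner_cfcHom_cfcHom]
  exact inner_self_nonneg (𝕜 := ℂ)

/-- The positive functional `φ ↦ ⟨φ(T)u, u⟩`. All continuous functions on the compact spectrum
are compactly supported; the latter type is the one for which the Riesz representation theorem is
stated. -/
def spectralFunctional (u : H) : CompactlySupportedContinuousMap (spectrum ℝ T) ℝ →ₚ[ℝ] ℝ :=
  PositiveLinearMap.mk₀
    { toFun φ := (inner ℂ u (cfcHom hT φ.toContinuousMap u)).re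
      map_add' φ ψ := by
        rw [show (φ + ψ).toContinuousMap = φ.toContinuousMap + ψ.toContinuousMap from rfl,
          map_add, add_apply, inner_add_right, Complex.add_re]
      map_smul' c φ := by
        rw [show (c • φ).toContinuousMap = c • φ.toContinuousMap from rfl, map_smul, smul_apply,
          ← Complex.coe_smul, inner_smul_right, Complex.re_ofReal_mul, RingHom.id_apply,
          smul_eq_mul] }
    fun _ hφ => re_inner_cfcHom_self_nonneg hT hφ u

/-- The measure `μ_u` on the spectrum of `T` with `⟨φ(T)u, u⟩ = ∫ φ dμ_u` for continuous `φ`. -/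
def scalarSpectralMeasure (u : H) : Measure (spectrum ℝ T) :=
  RealRMK.rieszMeasure (spectralFunctional hT u)

instance (u : H) : IsFiniteMeasure (scalarSpectralMeasure hT u) :=
  inferInstanceAs (IsFiniteMeasure (RealRMK.rieszMeasure (spectralFunctional hT u)))

theorem inner_cfcHom_self (φ : C(spectrum ℝ T, ℝ)) (u : H) :
    inner ℂ u (cfcHom hT φ u) = ((∫ t, φ t ∂scalarSpectralMeasure hT u : ℝ) : ℂ) := by
  rw [← ofReal_re_inner_cfcHom_self]
  exact congrArg _ (RealRMK.integral_rieszMeasure (spectralFunctional hT u)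
    (CompactlySupportedContinuousMap.continuousMapEquiv φ)).symm

/-- The inclusion of the continuous functions in `L²(μ_u)`. -/
abbrev continuousToL2 (u : H) : C(spectrum ℝ T, ℝ) →L[ℝ] Lp ℝ 2 (scalarSpectralMeasure hT u) :=
  ContinuousMap.toLp 2 (scalarSpectralMeasure hT u) ℝ

theorem denseRange_continuousToL2 (u : H) : DenseRange (continuousToL2 hT u) :=
  ContinuousMap.toLp_denseRange ℝ (scalarSpectralMeasure hT u) ℝ ENNReal.ofNat_ne_top

theorem inner_cfcHom_eq_inner_continuousToL2 (φ ψ : C(spectrum ℝ T, ℝ)) (u : H) :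
    inner ℂ (cfcHom hT φ u) (cfcHom hT ψ u) =
      ((inner ℝ (continuousToL2 hT u φ) (continuousToL2 hT u ψ) : ℝ) : ℂ) := by
  rw [inner_cfcHom_cfcHom, inner_cfcHom_self, ContinuousMap.inner_toLp]
  congr 2 with t
  exact mul_comm _ _

theorem norm_cfcHom_apply (φ : C(spectrum ℝ T, ℝ)) (u : H) :
    ‖cfcHom hT φ u‖ = ‖continuousToL2 hT u φ‖ :=
  norm_eq_norm_of_inner_self_eq_ofReal (inner_cfcHom_eq_inner_continuousToL2 hT φ φ u)

/-- The evaluation `φ ↦ φ(T)u` on continuous functions. -/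
def cfcEval (u : H) : C(spectrum ℝ T, ℝ) →ₗ[ℝ] H where
  toFun φ := cfcHom hT φ u
  map_add' φ ψ := by rw [map_add, add_apply]
  map_smul' c φ := by rw [map_smul, smul_apply, RingHom.id_apply]

/-- The isometry `L²(μ_u) → H` extending `φ ↦ φ(T)u`, that is, the Borel functional calculus of `T`
evaluated at `u`. -/
def spectralIsometry (u : H) : Lp ℝ 2 (scalarSpectralMeasure hT u) →L[ℝ] H :=
  (cfcEval hT u).extendOfNorm (continuousToL2 hT u).toLinearMap

theorem spectralIsometry_continuousToL2 (φ : C(spectrum ℝ T, ℝ)) (u : H) :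
    spectralIsometry hT u (continuousToL2 hT u φ) = cfcHom hT φ u :=
  LinearMap.extendOfNorm_eq (f := cfcEval hT u) (e := (continuousToL2 hT u).toLinearMap)
    (denseRange_continuousToL2 hT u)
    ⟨1, fun ψ => (norm_cfcHom_apply hT ψ u).le.trans_eq (one_mul _).symm⟩ φ

theorem inner_spectralIsometry (u : H) (g h : Lp ℝ 2 (scalarSpectralMeasure hT u)) :
    inner ℂ (spectralIsometry hT u g) (spectralIsometry hT u h) = ((inner ℝ g h : ℝ) : ℂ) := by
  refine (denseRange_continuousToL2 hT u).induction_on₂ (p := fun g h =>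
    inner ℂ (spectralIsometry hT u g) (spectralIsometry hT u h) = ((inner ℝ g h : ℝ) : ℂ))
    (isClosed_eq (by fun_prop) (by fun_prop)) (fun φ ψ => ?_) g h
  rw [spectralIsometry_continuousToL2, spectralIsometry_continuousToL2,
    inner_cfcHom_eq_inner_continuousToL2]

theorem norm_spectralIsometry (u : H) (g : Lp ℝ 2 (scalarSpectralMeasure hT u)) :
    ‖spectralIsometry hT u g‖ = ‖g‖ :=
  norm_eq_norm_of_inner_self_eq_ofReal (inner_spectralIsometry hT u g g)

section SpectralVector

variable {ω ω' : Set (spectrum ℝ T)} (hω : MeasurableSet ω)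

/-- The vector `1_ω(T)u`, as a function of `u` before it is known to be linear. -/
def spectralVector (u : H) : H :=
  spectralIsometry hT u (indicatorConstLp 2 hω (measure_ne_top _ ω) (1 : ℝ))

theorem inner_spectralVector (hω' : MeasurableSet ω') (u : H) :
    inner ℂ (spectralVector hT hω u) (spectralVector hT hω' u) =
      ((scalarSpectralMeasure hT u).real (ω ∩ ω') : ℂ) := by
  rw [spectralVector, spectralVector, inner_spectralIsometry, L2.inner_indicatorConstLp_one,
    setIntegral_congr_ae hω (g := ω'.indicator fun _ => (1 : ℝ))
      (indicatorConstLp_coeFn.mono fun _ ht _ => ht),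
    setIntegral_indicator hω', setIntegral_const, smul_eq_mul, mul_one]

theorem norm_spectralVector_sq (u : H) :
    ‖spectralVector hT hω u‖ ^ 2 = (scalarSpectralMeasure hT u).real ω := by
  rw [← inner_self_eq_ofReal_iff, inner_spectralVector, Set.inter_self]

theorem edist_cfcHom_spectralVector (φ : C(spectrum ℝ T, ℝ)) (u : H) :
    edist (cfcHom hT φ u) (spectralVector hT hω u) =
      eLpNorm (ω.indicator (fun _ => (1 : ℝ)) - (φ : spectrum ℝ T → ℝ)) 2
        (scalarSpectralMeasure hT u) := by
  rw [edist_comm, edist_eq_enorm_sub, spectralVector, ← spectralIsometry_continuousToL2, ← map_sub,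
    ← ofReal_norm, norm_spectralIsometry, ofReal_norm, Lp.enorm_def]
  refine eLpNorm_congr_ae ((Lp.coeFn_sub _ _).trans (EventuallyEq.sub ?_ ?_))
  · exact indicatorConstLp_coeFn
  · exact ContinuousMap.coeFn_toLp _ _

theorem spectralVector_univ (u : H) : spectralVector hT .univ u = u := by
  have h := edist_cfcHom_spectralVector hT .univ 1 u
  rw [map_one, one_apply_eq_self, Set.indicator_univ, ContinuousMap.coe_one,
    show (fun _ => (1 : ℝ)) - (1 : spectrum ℝ T → ℝ) = 0 from sub_self _, eLpNorm_zero] at h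
  exact (edist_eq_zero.1 h).symm

theorem norm_spectralVector_le (u : H) : ‖spectralVector hT hω u‖ ≤ ‖u‖ := by
  refine le_of_sq_le_sq ?_ (norm_nonneg _)
  rw [norm_spectralVector_sq, ← congrArg norm (spectralVector_univ hT u), norm_spectralVector_sq]
  exact measureReal_mono (Set.subset_univ ω)

/-- A single sequence `φₙ` must serve all the vectors involved for the linearity of `φₙ(T)` to
pass to the limit, whence the dominating measure `ν`. -/
theorem exists_tendsto_cfcHom_spectralVector (ν : Measure (spectrum ℝ T)) [IsFiniteMeasure ν] :
    ∃ φ : ℕ → C(spectrum ℝ T, ℝ), ∀ u, scalarSpectralMeasure hT u ≤ ν →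
      Tendsto (fun n => cfcHom hT (φ n) u) atTop (𝓝 (spectralVector hT hω u)) := by
  obtain ⟨φ, hφ⟩ := exists_continuous_tendsto_eLpNorm_sub ENNReal.ofNat_ne_top
    (memLp_indicator_const (μ := ν) 2 hω (1 : ℝ) (.inr (measure_ne_top ν ω)))
  refine ⟨φ, fun u hu => tendsto_iff_edist_tendsto_0.2 ?_⟩
  simp_rw [edist_cfcHom_spectralVector]
  exact tendsto_of_tendsto_of_tendsto_of_le_of_le tendsto_const_nhds hφ (fun _ => zero_le)
    fun _ => eLpNorm_mono_measure _ hu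

theorem spectralVector_add (u v : H) :
    spectralVector hT hω (u + v) = spectralVector hT hω u + spectralVector hT hω v := by
  obtain ⟨φ, hφ⟩ := exists_tendsto_cfcHom_spectralVector hT hω (scalarSpectralMeasure hT u +
    scalarSpectralMeasure hT v + scalarSpectralMeasure hT (u + v))
  have tendsto_u := hφ u ((Measure.le_add_right le_rfl).trans (Measure.le_add_right le_rfl))
  have tendsto_v := hφ v ((Measure.le_add_left le_rfl).trans (Measure.le_add_right le_rfl))
  refine tendsto_nhds_unique (hφ (u + v) (Measure.le_add_left le_rfl)) ?_
  simp_rw [map_add]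
  exact tendsto_u.add tendsto_v

theorem spectralVector_smul (c : ℂ) (u : H) :
    spectralVector hT hω (c • u) = c • spectralVector hT hω u := by
  obtain ⟨φ, hφ⟩ := exists_tendsto_cfcHom_spectralVector hT hω (scalarSpectralMeasure hT u +
    scalarSpectralMeasure hT (c • u))
  refine tendsto_nhds_unique (hφ (c • u) (Measure.le_add_left le_rfl)) ?_
  simp_rw [map_smul]
  exact (hφ u (Measure.le_add_right le_rfl)).const_smul c

end SpectralVector

open Classical in
/-- The spectral projection `1_ω(T)`, set to `0` if `ω` is not measurable. -/
def spectralProjection (ω : Set (spectrum ℝ T)) : H →L[ℂ] H :=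
  if hω : MeasurableSet ω then
    LinearMap.mkContinuous
      { toFun := spectralVector hT hω
        map_add' := spectralVector_add hT hω
        map_smul' := spectralVector_smul hT hω } 1
      fun u => (norm_spectralVector_le hT hω u).trans_eq (one_mul _).symm
  else 0

theorem spectralProjection_apply {ω : Set (spectrum ℝ T)} (hω : MeasurableSet ω) (u : H) :
    spectralProjection hT ω u = spectralVector hT hω u := by
  rw [spectralProjection, dif_pos hω]
  rfl

theorem spectralProjection_univ : spectralProjection hT Set.univ = 1 :=
  ContinuousLinearMap.ext fun u =>
    (spectralProjection_apply hT .univ u).trans (spectralVector_univ hT u)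

theorem inner_spectralProjection_spectralProjection {ω ω' : Set (spectrum ℝ T)}
    (hω : MeasurableSet ω) (hω' : MeasurableSet ω') (u : H) :
    inner ℂ (spectralProjection hT ω u) (spectralProjection hT ω' u) =
      ((scalarSpectralMeasure hT u).real (ω ∩ ω') : ℂ) := by
  rw [spectralProjection_apply hT hω, spectralProjection_apply hT hω', inner_spectralVector]

theorem inner_spectralProjection_self {ω : Set (spectrum ℝ T)} (hω : MeasurableSet ω) (u : H) :
    inner ℂ (spectralProjection hT ω u) u = ((scalarSpectralMeasure hT u).real ω : ℂ) := by
  have h := inner_spectralProjection_spectralProjection hT hω .univ u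
  rwa [spectralProjection_univ, one_apply_eq_self, Set.inter_univ] at h

theorem isSelfAdjoint_spectralProjection {ω : Set (spectrum ℝ T)} (hω : MeasurableSet ω) :
    IsSelfAdjoint (spectralProjection hT ω) := by
  rw [ContinuousLinearMap.isSelfAdjoint_iff_isSymmetric,
    LinearMap.isSymmetric_iff_inner_map_self_real]
  intro u
  rw [ContinuousLinearMap.coe_coe, inner_spectralProjection_self hT hω]
  exact Complex.conj_ofReal _

theorem inner_spectralProjection_left {ω : Set (spectrum ℝ T)} (hω : MeasurableSet ω) (u v : H) :
    inner ℂ (spectralProjection hT ω u) v = inner ℂ u (spectralProjection hT ω v) :=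
  (isSelfAdjoint_spectralProjection hT hω).isSymmetric u v

theorem spectralProjection_inter {ω ω' : Set (spectrum ℝ T)} (hω : MeasurableSet ω)
    (hω' : MeasurableSet ω') :
    spectralProjection hT (ω ∩ ω') = spectralProjection hT ω * spectralProjection hT ω' :=
  eq_of_forall_inner_self_eq fun u => by
    rw [mul_apply_eq_comp, ← inner_spectralProjection_left hT hω,
      inner_spectralProjection_spectralProjection hT hω hω',
      ← inner_spectralProjection_left hT (hω.inter hω'),
      inner_spectralProjection_self hT (hω.inter hω')]

theorem spectralProjection_union {ω ω' : Set (spectrum ℝ T)} (hω : MeasurableSet ω)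
    (hω' : MeasurableSet ω') (hd : Disjoint ω ω') :
    spectralProjection hT (ω ∪ ω') = spectralProjection hT ω + spectralProjection hT ω' :=
  eq_of_forall_inner_self_eq fun u => by
    rw [add_apply, inner_add_right, ← inner_spectralProjection_left hT (hω.union hω'),
      ← inner_spectralProjection_left hT hω, ← inner_spectralProjection_left hT hω',
      inner_spectralProjection_self hT (hω.union hω'), inner_spectralProjection_self hT hω,
      inner_spectralProjection_self hT hω', measureReal_union hd hω', Complex.ofReal_add]

theorem hasSum_inner_spectralProjection {ω : ℕ → Set (spectrum ℝ T)}
    (hω : ∀ n, MeasurableSet (ω n)) (hd : Pairwise (Function.onFun Disjoint ω)) (u v : H) :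
    HasSum (fun n => inner ℂ v (spectralProjection hT (ω n) u))
      (inner ℂ v (spectralProjection hT (⋃ n, ω n) u)) := by
  simp_rw [← inner_spectralProjection_left hT (hω _),
    ← inner_spectralProjection_left hT (.iUnion hω)]
  refine hasSum_inner_of_forall_hasSum_inner_self (fun w => ?_) v u
  simp_rw [inner_spectralProjection_self hT (hω _),
    inner_spectralProjection_self hT (.iUnion hω)]
  exact Complex.hasSum_ofReal.2 (hasSum_measureReal_iUnion _ hω hd)

/-- The spectral measure `ω ↦ 1_ω(T)` of a bounded selfadjoint operator `T`. -/
def boundedSpectralMeasure : SpectralMeasure (spectrum ℝ T) H where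
  toFun := spectralProjection hT
  not_measurable _ hω := dif_neg hω
  isStarProjection ω hω := by
    refine ⟨?_, isSelfAdjoint_spectralProjection hT hω⟩
    rw [IsIdempotentElem, ← spectralProjection_inter hT hω hω, Set.inter_self]
  empty := eq_of_forall_inner_self_eq fun u => by
    rw [← inner_spectralProjection_left hT .empty, inner_spectralProjection_self hT .empty,
      measureReal_empty, Complex.ofReal_zero, zero_apply, inner_zero_right]
  univ := spectralProjection_univ hT
  inter _ _ := spectralProjection_inter hT
  union _ _ := spectralProjection_union hT
  hasSum_inner u v _ hω hd := hasSum_inner_spectralProjection hT hω hd u v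

theorem variation_boundedSpectralMeasure (u : H) :
    ((boundedSpectralMeasure hT).complexMeasure u u).variation = scalarSpectralMeasure hT u := by
  ext ω hω
  rw [SpectralMeasure.variation_self_apply _ u hω, boundedSpectralMeasure,
    spectralProjection_apply hT hω, norm_spectralVector_sq, ofReal_measureReal]

theorem isBoundedMeasurable_coe_spectrum : IsBoundedMeasurable fun t : spectrum ℝ T => (t : ℝ) :=
  isBoundedMeasurable_coe_of_isCompact (spectrum.isCompact T)

theorem boundedIntegral_boundedSpectralMeasure :
    (boundedSpectralMeasure hT).boundedIntegral (fun t => (t : ℝ)) = T := by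
  refine eq_of_forall_inner_self_eq fun u => ?_
  have h := inner_cfcHom_self hT ((ContinuousMap.id ℝ).restrict (spectrum ℝ T)) u
  rw [cfcHom_id] at h
  rw [SpectralMeasure.inner_boundedIntegral_self isBoundedMeasurable_coe_spectrum, h,
    variation_boundedSpectralMeasure]
  rfl

theorem boundedSpectralMeasure_zero_of_injective (hinj : Function.Injective T) :
    (boundedSpectralMeasure hT).toFun {t | (t : ℝ) = 0} = 0 := by
  have hZ : MeasurableSet {t : spectrum ℝ T | (t : ℝ) = 0} :=
    measurableSet_eq_fun measurable_subtype_coe measurable_const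
  have indicator_eq : {t : spectrum ℝ T | (t : ℝ) = 0}.indicator (fun t => (t : ℝ)) =
      (∅ : Set (spectrum ℝ T)).indicator fun _ => 1 := by
    rw [Set.indicator_empty]
    exact Set.indicator_eq_zero.2 (Set.disjoint_left.2 fun t ht hZt => ht hZt)
  ext u
  refine hinj ?_
  rw [← congrFun (congrArg DFunLike.coe (boundedIntegral_boundedSpectralMeasure hT)),
    SpectralMeasure.boundedIntegral_toFun hZ isBoundedMeasurable_coe_spectrum, indicator_eq,
    SpectralMeasure.boundedIntegral_indicator_one .empty, SpectralMeasure.empty, zero_apply,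
    map_zero]

end BoundedSelfAdjoint

/-! ### The bounded inverse of a strictly positive operator -/

theorem inv_mem_spectrum_iff_not_isUnit {𝕜 R : Type*} [Field 𝕜] [Ring R] [Algebra 𝕜 R] {a : R}
    {s : 𝕜} (hs : s ≠ 0) : s⁻¹ ∈ spectrum 𝕜 a ↔ ¬ IsUnit (s • a - 1) := by
  have hsub : s • a - 1 = Units.mk0 (-s) (neg_ne_zero.2 hs) • (algebraMap 𝕜 R s⁻¹ - a) := by
    rw [Units.smul_mk0, Algebra.algebraMap_eq_smul_one, smul_sub, smul_smul, neg_mul,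
      mul_inv_cancel₀ hs]
    module
  rw [spectrum.mem_iff, hsub, isUnit_smul_iff]

namespace StrictlyPositiveOperator

variable {H : Type*} [NormedAddCommGroup H] [InnerProductSpace ℂ H] [CompleteSpace H]
  (A : StrictlyPositiveOperator H)

theorem exists_inverse : ∃ T : H →L[ℂ] H, ∀ u w : H, (u, w) ∈ A.op.graph ↔ T w = u := by
  have zero_mem : ((0 : ℝ) : ℂ) ∈ A.op.unboundedResolventSet := by
    by_contra h
    exact lt_irrefl _ (A.pos_of_mem_spectrum (s := 0) h)
  obtain ⟨R, hright, hleft⟩ := zero_mem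
  simp only [Complex.ofReal_zero, zero_smul, zero_sub, map_neg] at hright hleft
  refine ⟨-R, fun u w => ?_⟩
  rw [LinearPMap.mem_graph_iff]
  constructor
  · rintro ⟨v, rfl, rfl⟩
    exact hleft v
  · rintro rfl
    obtain ⟨v, hRv, hAv⟩ := hright w
    exact ⟨-v, by simp [hRv], by simpa [LinearPMap.map_neg] using hAv⟩

/-- The bounded inverse `A⁻¹`. -/
def inverse : H →L[ℂ] H := A.exists_inverse.choose

theorem mem_graph_iff (u w : H) : (u, w) ∈ A.op.graph ↔ A.inverse w = u :=
  A.exists_inverse.choose_spec u w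

theorem inverse_op (u : A.op.domain) : A.inverse (A.op u) = u :=
  (A.mem_graph_iff _ _).1 (A.op.mem_graph u)

theorem exists_op_eq (x : H) : ∃ u : A.op.domain, (u : H) = A.inverse x ∧ A.op u = x :=
  (LinearPMap.mem_graph_iff _).1 ((A.mem_graph_iff _ x).2 rfl)

theorem inverse_injective : Function.Injective A.inverse := by
  rw [injective_iff_map_eq_zero]
  intro w hw
  obtain ⟨u, hu, rfl⟩ := A.exists_op_eq w
  rw [hw, ZeroMemClass.coe_eq_zero] at hu
  rw [hu, LinearPMap.map_zero]

theorem isSelfAdjoint_inverse : IsSelfAdjoint A.inverse := by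
  rw [ContinuousLinearMap.isSelfAdjoint_iff_isSymmetric]
  intro x y
  obtain ⟨u, hu, rfl⟩ := A.exists_op_eq x
  obtain ⟨v, hv, rfl⟩ := A.exists_op_eq y
  have hformal := LinearPMap.adjoint_isFormalAdjoint A.isSelfAdjoint.dense_domain (T := A.op)
  rw [LinearPMap.isSelfAdjoint_def.1 A.isSelfAdjoint] at hformal
  exact hu ▸ hv ▸ (hformal u v).symm

theorem isUnit_of_mem_unboundedResolventSet {z : ℂ} (hz : z ∈ A.op.unboundedResolventSet) :
    IsUnit (z • A.inverse - 1) := by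
  obtain ⟨R, hright, hleft⟩ := hz
  refine isUnit_iff_exists.2 ⟨z • R - 1, ?_, ?_⟩
  · ext x
    obtain ⟨u, hRx, hu⟩ := hright x
    have hop : (z • R - 1) x = A.op u := by
      simp only [sub_apply, smul_apply, one_apply_eq_self, hRx]
      nth_rewrite 1 [← hu]
      abel
    rw [mul_apply_eq_comp, hop]
    simp only [sub_apply, smul_apply, one_apply_eq_self, inverse_op, hu]
  · ext x
    obtain ⟨u, hu, rfl⟩ := A.exists_op_eq x
    simp only [mul_apply_eq_comp, sub_apply, smul_apply, one_apply_eq_self, ← hu, hleft u]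
    abel

theorem mem_unboundedResolventSet_of_isUnit {z : ℂ} (hz : IsUnit (z • A.inverse - 1)) :
    z ∈ A.op.unboundedResolventSet := by
  obtain ⟨B, hright, hleft⟩ := isUnit_iff_exists.1 hz
  refine ⟨A.inverse * B, fun x => ?_, fun u => ?_⟩
  · obtain ⟨u, hu, hAu⟩ := A.exists_op_eq (B x)
    refine ⟨u, hu.symm, ?_⟩
    rw [hu, hAu]
    exact DFunLike.congr_fun hright x
  · rw [mul_apply_eq_comp]
    nth_rewrite 1 [← A.inverse_op u]
    exact (congrArg A.inverse (DFunLike.congr_fun hleft (A.op u))).trans (A.inverse_op u)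

theorem mem_spectrum_iff (s : ℝ) :
    s ∈ A.spectrum ↔ s ≠ 0 ∧ s⁻¹ ∈ _root_.spectrum ℝ A.inverse := by
  rcases eq_or_ne s 0 with rfl | hs
  · exact ⟨fun h => (A.pos_of_mem_spectrum h).false.elim, fun h => (h.1 rfl).elim⟩
  rw [inv_mem_spectrum_iff_not_isUnit hs, and_iff_right hs, ← Complex.coe_smul]
  exact not_congr ⟨A.isUnit_of_mem_unboundedResolventSet, A.mem_unboundedResolventSet_of_isUnit⟩

theorem exists_inv_le : ∃ C : ℝ, ∀ s ∈ A.spectrum, s⁻¹ ≤ C :=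
  ⟨‖A.inverse‖ * ‖(1 : H →L[ℂ] H)‖, fun s hs => (le_abs_self _).trans
    (spectrum.norm_le_norm_mul_of_mem ((A.mem_spectrum_iff s).1 hs).2)⟩

end StrictlyPositiveOperator

/-! ### The spectral measure of a strictly positive operator -/

namespace SpectralMeasure

variable {Ω Ω' : Type*} [MeasurableSpace Ω] [MeasurableSpace Ω'] {H : Type*}
  [NormedAddCommGroup H] [InnerProductSpace ℂ H] [CompleteSpace H]
  (E : SpectralMeasure Ω' H) {j : Ω → Ω'} (hj : MeasurableEmbedding j)
  (hrange : E.toFun (Set.range j) = 1)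

/-- The pullback of a spectral measure along a measurable embedding whose range carries it. -/
def comap : SpectralMeasure Ω H where
  toFun ω := E.toFun (j '' ω)
  not_measurable ω hω := E.not_measurable _ fun h => hω (hj.measurableSet_image.1 h)
  isStarProjection ω hω := E.isStarProjection _ (hj.measurableSet_image.2 hω)
  empty := by rw [Set.image_empty, E.empty]
  univ := by rw [Set.image_univ, hrange]
  inter ω₁ ω₂ h₁ h₂ := by
    rw [Set.image_inter hj.injective,
      E.inter _ _ (hj.measurableSet_image.2 h₁) (hj.measurableSet_image.2 h₂)]
  union ω₁ ω₂ h₁ h₂ hd := by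
    rw [Set.image_union, E.union _ _ (hj.measurableSet_image.2 h₁) (hj.measurableSet_image.2 h₂)
      (Set.disjoint_image_of_injective hj.injective hd)]
  hasSum_inner u v ω hω hd := by
    rw [Set.image_iUnion]
    exact E.hasSum_inner u v _ (fun n => hj.measurableSet_image.2 (hω n))
      fun m n hmn => Set.disjoint_image_of_injective hj.injective (hd hmn)

theorem map_variation_comap (u : H) :
    ((E.comap hj hrange).complexMeasure u u).variation.map j =
      (E.complexMeasure u u).variation := by
  ext ω hω
  rw [hj.map_apply, variation_self_apply _ u (hj.measurable hω), variation_self_apply _ u hω,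
    show (E.comap hj hrange).toFun (j ⁻¹' ω) = E.toFun (j '' (j ⁻¹' ω)) from rfl,
    Set.image_preimage_eq_inter_range, E.inter _ _ hω hj.measurableSet_range, hrange, mul_one]

theorem boundedIntegral_comap {g : Ω' → ℝ} (hg : IsBoundedMeasurable g) :
    (E.comap hj hrange).boundedIntegral (g ∘ j) = E.boundedIntegral g :=
  eq_of_forall_inner_self_eq fun u => by
    rw [inner_boundedIntegral_self (hg.comp hj.measurable), inner_boundedIntegral_self hg,
      ← E.map_variation_comap hj hrange, hj.integral_map]
    rfl

end SpectralMeasure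

namespace StrictlyPositiveOperator

variable {H : Type*} [NormedAddCommGroup H] [InnerProductSpace ℂ H] [CompleteSpace H]
  (A : StrictlyPositiveOperator H)

/-- The map `s ↦ s⁻¹` from `σ(A)` to `σ(A⁻¹)`. -/
def invSpectrum (s : A.spectrum) : _root_.spectrum ℝ A.inverse :=
  ⟨(s : ℝ)⁻¹, ((A.mem_spectrum_iff s).1 s.2).2⟩

theorem image_invSpectrum_preimage (ω : Set ℝ) :
    A.invSpectrum '' (Subtype.val ⁻¹' ω) =
      {t : _root_.spectrum ℝ A.inverse | (t : ℝ) ≠ 0 ∧ (t : ℝ)⁻¹ ∈ ω} := by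
  ext t
  constructor
  · rintro ⟨s, hs, rfl⟩
    exact ⟨inv_ne_zero (A.pos_of_mem_spectrum s.2).ne', (inv_inv (s : ℝ)).symm ▸ hs⟩
  · rintro ⟨ht0, ht⟩
    have inv_mem : (t : ℝ)⁻¹ ∈ A.spectrum :=
      (A.mem_spectrum_iff _).2 ⟨inv_ne_zero ht0, (inv_inv (t : ℝ)).symm ▸ t.2⟩
    exact ⟨⟨_, inv_mem⟩, ht, Subtype.ext (inv_inv _)⟩

theorem range_invSpectrum :
    Set.range A.invSpectrum = {t : _root_.spectrum ℝ A.inverse | (t : ℝ) = 0}ᶜ := by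
  rw [← Set.image_univ, ← Set.preimage_univ, image_invSpectrum_preimage]
  simp only [Set.mem_univ, and_true]
  rfl

theorem measurableEmbedding_invSpectrum : MeasurableEmbedding A.invSpectrum where
  injective _ _ h := Subtype.ext (inv_injective (congrArg Subtype.val h))
  measurable := measurable_subtype_coe.inv.subtype_mk
  measurableSet_image' := by
    rintro _ ⟨ω, hω, rfl⟩
    rw [image_invSpectrum_preimage]
    exact (measurableSet_eq_fun measurable_subtype_coe measurable_const).compl.inter
      (measurable_subtype_coe.inv hω)

theorem boundedSpectralMeasure_range_invSpectrum :
    (boundedSpectralMeasure A.isSelfAdjoint_inverse).toFun (Set.range A.invSpectrum) = 1 := by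
  rw [range_invSpectrum, SpectralMeasure.toFun_compl _
    (measurableSet_eq_fun measurable_subtype_coe measurable_const),
    boundedSpectralMeasure_zero_of_injective _ A.inverse_injective, sub_zero]

/-- The spectral measure of `A`, pulled back from that of `A⁻¹` along `s ↦ s⁻¹`. -/
def spectralMeasure : SpectralMeasure A.spectrum H :=
  (boundedSpectralMeasure A.isSelfAdjoint_inverse).comap A.measurableEmbedding_invSpectrum
    A.boundedSpectralMeasure_range_invSpectrum

theorem boundedIntegral_inv_spectralMeasure :
    A.spectralMeasure.boundedIntegral (fun s => (s : ℝ)⁻¹) = A.inverse :=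
  (SpectralMeasure.boundedIntegral_comap _ _ _ isBoundedMeasurable_coe_spectrum).trans
    (boundedIntegral_boundedSpectralMeasure A.isSelfAdjoint_inverse)

theorem isBoundedMeasurable_inv : IsBoundedMeasurable fun s : A.spectrum => (s : ℝ)⁻¹ :=
  isBoundedMeasurable_coe_spectrum.comp A.measurableEmbedding_invSpectrum.measurable

theorem isSpectralMeasure_spectralMeasure : A.IsSpectralMeasure A.spectralMeasure := by
  refine LinearPMap.eq_of_eq_graph ?_
  have coe_mul_inv : (fun s : A.spectrum => (s : ℝ)) * (fun s : A.spectrum => (s : ℝ)⁻¹) = 1 :=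
    funext fun s => mul_inv_cancel₀ (A.pos_of_mem_spectrum s.2).ne'
  ext ⟨u, w⟩
  rw [SpectralMeasure.graph_integral, A.mem_graph_iff,
    SpectralMeasure.mem_integralGraph_iff_of_mul_eq_one measurable_subtype_coe
      A.isBoundedMeasurable_inv coe_mul_inv,
    boundedIntegral_inv_spectralMeasure]

end StrictlyPositiveOperator

/-! ### Strong limits of truncated exponential semigroups -/

section ExpSemigroup

variable {X : Type*} [NormedAddCommGroup X] [NormedSpace ℂ X]

/-- The semigroup `e^{tG}` of a bounded operator. -/
def expSemigroup (G : X →L[ℂ] X) (t : ℝ) : X →L[ℂ] X := NormedSpace.exp (t • G)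

theorem expSemigroup_zero (G : X →L[ℂ] X) : expSemigroup G 0 = 1 := by
  simp [expSemigroup]

variable [CompleteSpace X]

theorem expSemigroup_add (G : X →L[ℂ] X) (s t : ℝ) :
    expSemigroup G (s + t) = expSemigroup G s * expSemigroup G t := by
  let _ : NormedAlgebra ℚ (X →L[ℂ] X) := .restrictScalars ℚ ℂ _
  rw [expSemigroup, add_smul]
  exact NormedSpace.exp_add_of_commute (((Commute.refl G).smul_left s).smul_right t)

theorem semiconjBy_expSemigroup {Q G₁ G₂ : X →L[ℂ] X} (h : SemiconjBy Q G₁ G₂) (t : ℝ) :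
    SemiconjBy Q (expSemigroup G₁ t) (expSemigroup G₂ t) := by
  let _ : NormedAlgebra ℚ (X →L[ℂ] X) := .restrictScalars ℚ ℂ _
  refine SemiconjBy.exp_right ?_
  rw [SemiconjBy, mul_smul_comm, smul_mul_assoc, h.eq]

theorem semiconjBy_expSemigroup_apply {Q G₁ G₂ : X →L[ℂ] X} (h : SemiconjBy Q G₁ G₂) (t : ℝ)
    (x : X) : expSemigroup G₂ t (Q x) = Q (expSemigroup G₁ t x) :=
  (DFunLike.congr_fun (semiconjBy_expSemigroup h t).eq x).symm

theorem hasDerivAt_expSemigroup (G : X →L[ℂ] X) (x : X) (t : ℝ) :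
    HasDerivAt (fun r => expSemigroup G r x) (expSemigroup G t (G x)) t :=
  (((ContinuousLinearMap.apply ℂ X x).restrictScalars ℝ).hasFDerivAt).comp_hasDerivAt t
    (hasDerivAt_exp_smul_const (𝕂 := ℝ) G t)

theorem tendsto_expSemigroup_zero (G : X →L[ℂ] X) (x : X) :
    Tendsto (fun t : ℝ≥0 => expSemigroup G t x) (𝓝 0) (𝓝 x) := by
  simpa [expSemigroup_zero, Function.comp_def] using
    ((hasDerivAt_expSemigroup G x 0).continuousAt.tendsto).comp (NNReal.continuous_coe.tendsto 0)

theorem tendsto_slope_expSemigroup (G : X →L[ℂ] X) (x : X) :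
    Tendsto (fun t : ℝ≥0 => ((t : ℝ) : ℂ)⁻¹ • (expSemigroup G t x - x)) (𝓝[>] 0) (𝓝 (G x)) := by
  have coe_tendsto : Tendsto ((↑) : ℝ≥0 → ℝ) (𝓝[>] 0) (𝓝[>] 0) := by
    refine tendsto_nhdsWithin_iff.2
      ⟨(NNReal.continuous_coe.tendsto 0).mono_left nhdsWithin_le_nhds, ?_⟩
    filter_upwards [self_mem_nhdsWithin] with t ht using NNReal.coe_pos.2 ht
  have hslope := (hasDerivAt_expSemigroup G x 0).tendsto_slope_zero_right.comp coe_tendsto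
  simp only [expSemigroup_zero, one_apply_eq_self, zero_add] at hslope
  refine hslope.congr fun t => ?_
  rw [← Complex.ofReal_inv, Complex.coe_smul]
  rfl

theorem norm_expSemigroup_sub_sub_le (G : X →L[ℂ] X) (x : X) {ε t : ℝ} (ht : 0 ≤ t)
    (hε : ∀ r ∈ Set.Ico 0 t, ‖expSemigroup G r (G x) - G x‖ ≤ ε) :
    ‖expSemigroup G t x - x - t • G x‖ ≤ ε * t := by
  have hderiv (r : ℝ) : HasDerivAt (fun r => expSemigroup G r x - r • G x)
      (expSemigroup G r (G x) - G x) r := by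
    simpa using (hasDerivAt_expSemigroup G x r).fun_sub ((hasDerivAt_id r).smul_const (G x))
  have hmean := norm_image_sub_le_of_norm_deriv_le_segment'
    (fun r _ => (hderiv r).hasDerivWithinAt) hε t ⟨ht, le_rfl⟩
  simpa [expSemigroup_zero, sub_right_comm] using hmean

end ExpSemigroup

theorem norm_expSemigroup_apply_le {X : Type*} [NormedAddCommGroup X] [InnerProductSpace ℂ X]
    [CompleteSpace X] {G : X →L[ℂ] X} (hG : ∀ x, (inner ℂ x (G x)).re ≤ 0) {t : ℝ} (ht : 0 ≤ t)
    (x : X) : ‖expSemigroup G t x‖ ≤ ‖x‖ := by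
  let _ : InnerProductSpace ℝ X := InnerProductSpace.rclikeToReal ℂ X
  have hantitone : Antitone fun r => ‖expSemigroup G r x‖ ^ 2 := by
    refine antitone_of_hasDerivAt_nonpos (fun r => (hasDerivAt_expSemigroup G x r).norm_sq)
      fun r => ?_
    rw [semiconjBy_expSemigroup_apply (Commute.refl G).semiconjBy]
    exact mul_nonpos_of_nonneg_of_nonpos zero_le_two (hG _)
  have hle := hantitone ht
  simp only [expSemigroup_zero, one_apply_eq_self] at hle
  exact le_of_sq_le_sq hle (norm_nonneg _)

/-- Bounded dissipative operators `G n`, compatible with commuting contractions `P n` which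
converge strongly to the identity: the truncations `𝔸 P n` of an unbounded generator `𝔸`. -/
structure TruncatedGenerator (X : Type*) [NormedAddCommGroup X] [InnerProductSpace ℂ X] where
  P : ℕ → X →L[ℂ] X
  G : ℕ → X →L[ℂ] X
  norm_P_le : ∀ n x, ‖P n x‖ ≤ ‖x‖
  tendsto_P : ∀ x, Tendsto (fun n => P n x) atTop (𝓝 x)
  commute : ∀ m n, Commute (P m) (G n)
  G_mul_P : ∀ m n, m ≤ n → G n * P m = G m
  dissipative : ∀ n x, (inner ℂ x (G n x)).re ≤ 0

namespace TruncatedGenerator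

variable {X : Type*} [NormedAddCommGroup X] [InnerProductSpace ℂ X] (D : TruncatedGenerator X)

theorem G_P (n : ℕ) (x : X) : D.G n (D.P n x) = D.G n x :=
  DFunLike.congr_fun (D.G_mul_P n n le_rfl) x

theorem semiconjBy {m n : ℕ} (hmn : m ≤ n) : SemiconjBy (D.P m) (D.G m) (D.G n) := by
  rw [SemiconjBy, (D.commute m m).eq, D.G_mul_P m m le_rfl, D.G_mul_P m n hmn]

theorem tendsto_norm_sub_P (x : X) : Tendsto (fun n => 2 * ‖x - D.P n x‖) atTop (𝓝 0) := by
  simpa using ((D.tendsto_P x).const_sub x).norm.const_mul 2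

variable [CompleteSpace X]

theorem expSemigroup_P {m n : ℕ} (hmn : m ≤ n) (t : ℝ) (x : X) :
    expSemigroup (D.G n) t (D.P m x) = expSemigroup (D.G m) t (D.P m x) := by
  rw [semiconjBy_expSemigroup_apply (D.semiconjBy hmn),
    semiconjBy_expSemigroup_apply (D.semiconjBy le_rfl)]

theorem norm_sub_le {m n : ℕ} (hmn : m ≤ n) {t : ℝ} (ht : 0 ≤ t) (x : X) :
    ‖expSemigroup (D.G n) t x - expSemigroup (D.G m) t x‖ ≤ 2 * ‖x - D.P m x‖ := by
  have hsub : expSemigroup (D.G n) t x - expSemigroup (D.G m) t x =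
      expSemigroup (D.G n) t (x - D.P m x) - expSemigroup (D.G m) t (x - D.P m x) := by
    rw [map_sub, map_sub, D.expSemigroup_P hmn, sub_sub_sub_cancel_right]
  rw [hsub, two_mul]
  exact norm_sub_le_of_le (norm_expSemigroup_apply_le (D.dissipative n) ht _)
    (norm_expSemigroup_apply_le (D.dissipative m) ht _)

theorem exists_limit {t : ℝ} (ht : 0 ≤ t) (x : X) :
    ∃ y, Tendsto (fun n => expSemigroup (D.G n) t x) atTop (𝓝 y) := by
  refine cauchySeq_tendsto_of_complete (Metric.cauchySeq_iff'.2 fun ε hε => ?_)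
  obtain ⟨N, hN⟩ := ((D.tendsto_norm_sub_P x).eventually_lt_const hε).exists
  exact ⟨N, fun n hn => by rw [dist_eq_norm]; exact (D.norm_sub_le hn ht x).trans_lt hN⟩

/-- The strong limit of the operators `e^{t G n}`. -/
def limit (t : ℝ≥0) : X →L[ℂ] X :=
  continuousLinearMapOfTendsto (fun n => expSemigroup (D.G n) t)
    (f := fun x => (D.exists_limit t.2 x).choose)
    (tendsto_pi_nhds.2 fun x => (D.exists_limit t.2 x).choose_spec)

theorem tendsto_limit (t : ℝ≥0) (x : X) :
    Tendsto (fun n => expSemigroup (D.G n) t x) atTop (𝓝 (D.limit t x)) :=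
  (D.exists_limit t.2 x).choose_spec

theorem norm_limit_le (t : ℝ≥0) (x : X) : ‖D.limit t x‖ ≤ ‖x‖ :=
  le_of_tendsto' (D.tendsto_limit t x).norm
    fun n => norm_expSemigroup_apply_le (D.dissipative n) t.2 x

theorem norm_limit_sub_le (m : ℕ) (t : ℝ≥0) (x : X) :
    ‖D.limit t x - expSemigroup (D.G m) t x‖ ≤ 2 * ‖x - D.P m x‖ :=
  le_of_tendsto ((D.tendsto_limit t x).sub_const _).norm <|
    (eventually_ge_atTop m).mono fun _ hn => D.norm_sub_le hn t.2 x

theorem P_limit (n : ℕ) (t : ℝ≥0) (x : X) :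
    D.P n (D.limit t x) = expSemigroup (D.G n) t (D.P n x) := by
  refine tendsto_nhds_unique (((D.P n).continuous.tendsto _).comp (D.tendsto_limit t x))
    (tendsto_const_nhds.congr' ?_)
  filter_upwards [eventually_ge_atTop n] with k hk
  rw [Function.comp_apply, ← semiconjBy_expSemigroup_apply (D.commute n k).semiconjBy,
    D.expSemigroup_P hk]

theorem limit_zero : D.limit 0 = 1 := by
  ext x
  refine tendsto_nhds_unique (D.tendsto_limit 0 x) ?_
  simp [expSemigroup_zero]

theorem limit_add (s t : ℝ≥0) (x : X) : D.limit (s + t) x = D.limit s (D.limit t x) := by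
  refine tendsto_nhds_unique (D.tendsto_limit (s + t) x)
    ((D.tendsto_limit s (D.limit t x)).congr_dist ?_)
  have hdist : Tendsto (fun n => dist (D.limit t x) (expSemigroup (D.G n) t x)) atTop (𝓝 0) := by
    simpa using (tendsto_const_nhds (x := D.limit t x)).dist (D.tendsto_limit t x)
  refine squeeze_zero (fun _ => dist_nonneg) (fun n => ?_) hdist
  rw [NNReal.coe_add, expSemigroup_add, mul_apply_eq_comp, dist_eq_norm, dist_eq_norm, ← map_sub]
  exact norm_expSemigroup_apply_le (D.dissipative n) s.2 _

theorem tendsto_limit_zero (x : X) : Tendsto (fun t => D.limit t x) (𝓝 0) (𝓝 x) := by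
  rw [Metric.tendsto_nhds]
  intro ε hε
  obtain ⟨m, hm⟩ := ((D.tendsto_norm_sub_P x).eventually_lt_const (half_pos hε)).exists
  filter_upwards [Metric.tendsto_nhds.1 (tendsto_expSemigroup_zero (D.G m) x) _ (half_pos hε)]
    with t ht
  have hlimit := D.norm_limit_sub_le m t x
  rw [← dist_eq_norm] at hlimit
  linarith [dist_triangle (D.limit t x) (expSemigroup (D.G m) t x) x]

/-- The contraction semigroup obtained as the strong limit of the semigroups `e^{t G n}`. -/
def semigroup : ContractionSemigroup X where
  toFun := D.limit
  map_zero := D.limit_zero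
  map_add s t := ContinuousLinearMap.ext (D.limit_add s t)
  tendsto_zero x := (D.tendsto_limit_zero x).mono_left nhdsWithin_le_nhds
  norm_le_one t := ContinuousLinearMap.opNorm_le_bound _ zero_le_one fun x => by
    rw [one_mul]; exact D.norm_limit_le t x

theorem norm_limit_sub_sub_le {x y : X} (h : ∀ n, D.G n x = D.P n y) {ε : ℝ} (t : ℝ≥0)
    (hε : ∀ r ≤ t, ‖D.limit r y - y‖ ≤ ε) :
    ‖D.limit t x - x - (t : ℝ) • y‖ ≤ ε * t := by
  refine le_of_tendsto' (D.tendsto_P _).norm fun n => ?_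
  rw [map_sub, map_sub, D.P_limit, ContinuousLinearMap.map_smul_of_tower, ← h, ← D.G_P]
  refine norm_expSemigroup_sub_sub_le _ _ t.2 fun r hr => ?_
  lift r to ℝ≥0 using hr.1
  rw [D.G_P, h, ← D.P_limit, ← map_sub]
  exact (D.norm_P_le _ _).trans (hε r (NNReal.coe_lt_coe.1 hr.2).le)

theorem tendsto_slope_limit {x y : X} (h : ∀ n, D.G n x = D.P n y) :
    Tendsto (fun t : ℝ≥0 => ((t : ℝ) : ℂ)⁻¹ • (D.limit t x - x)) (𝓝[>] 0) (𝓝 y) := by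
  rw [Metric.tendsto_nhds]
  intro ε hε
  obtain ⟨δ, hδ, hball⟩ := Metric.eventually_nhds_iff.1
    (Metric.tendsto_nhds.1 (D.tendsto_limit_zero y) (ε / 2) (half_pos hε))
  filter_upwards [nhdsWithin_le_nhds (Metric.ball_mem_nhds 0 hδ), self_mem_nhdsWithin]
    with t htδ ht
  have ht_pos : (0 : ℝ) < t := NNReal.coe_pos.2 ht
  have hbound := D.norm_limit_sub_sub_le h (ε := ε / 2) t fun r hr => by
    have hrt : dist r 0 ≤ dist t 0 := by simpa [NNReal.dist_eq] using hr
    rw [← dist_eq_norm]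
    exact (hball (hrt.trans_lt htδ)).le
  have hquot : ((t : ℝ) : ℂ)⁻¹ • (D.limit t x - x) - y =
      (t : ℝ)⁻¹ • (D.limit t x - x - (t : ℝ) • y) := by
    rw [← Complex.ofReal_inv, Complex.coe_smul, smul_sub _ (_ - _), smul_smul,
      inv_mul_cancel₀ ht_pos.ne', one_smul]
  rw [dist_eq_norm, hquot, norm_smul, Real.norm_of_nonneg (by positivity), inv_mul_lt_iff₀ ht_pos]
  nlinarith

theorem mem_generatorGraph_iff (p : X × X) :
    p ∈ D.semigroup.generatorGraph ↔ ∀ n, D.G n p.1 = D.P n p.2 := by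
  refine ⟨fun h n => ?_, D.tendsto_slope_limit⟩
  have hP : Tendsto (fun t : ℝ≥0 => ((t : ℝ) : ℂ)⁻¹ •
      (expSemigroup (D.G n) t (D.P n p.1) - D.P n p.1)) (𝓝[>] 0) (𝓝 (D.P n p.2)) := by
    refine (((D.P n).continuous.tendsto _).comp h).congr fun t => ?_
    rw [Function.comp_apply, map_smul, map_sub, ← D.P_limit]
    rfl
  rw [← D.G_P]
  exact tendsto_nhds_unique (tendsto_slope_expSemigroup _ _) hP

end TruncatedGenerator

/-! ### The truncated wave operator -/

theorem withLp_prod_ext_iff {α β : Type*} {p q : WithLp 2 (α × β)} :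
    p = q ↔ p.fst = q.fst ∧ p.snd = q.snd :=
  (WithLp.ofLp_injective 2).eq_iff.symm.trans Prod.ext_iff

section Wave

variable {K H : Type*} [NormedAddCommGroup K] [InnerProductSpace ℂ K]
  [NormedAddCommGroup H] [InnerProductSpace ℂ H]

/-- The operator `(u, v) ↦ (U⁻¹ Q U u, Q v)` on `K × H`. -/
def waveProjection (U : K ≃ₗᵢ[ℂ] H) (Q : H →L[ℂ] H) :
    WithLp 2 (K × H) →L[ℂ] WithLp 2 (K × H) :=
  (WithLp.prodContinuousLinearEquiv 2 ℂ K H).symm.toContinuousLinearMap ∘L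
    (U.symm.toContinuousLinearEquiv.toContinuousLinearMap ∘L Q ∘L
      U.toContinuousLinearEquiv.toContinuousLinearMap).prodMap Q ∘L
    (WithLp.prodContinuousLinearEquiv 2 ℂ K H).toContinuousLinearMap

/-- The operator `(u, v) ↦ (U⁻¹ R v, -(R U u + F v))` on `K × H`. With `K = D(A^{1/2})`,
`U = A^{1/2}`, and `R`, `F` truncations of `A^{1/2}` and `f(A)`, it is a truncation of
`(u, v) ↦ (v, -(A u + f(A) v))`. -/
def waveOperator (U : K ≃ₗᵢ[ℂ] H) (R F : H →L[ℂ] H) :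
    WithLp 2 (K × H) →L[ℂ] WithLp 2 (K × H) :=
  (WithLp.prodContinuousLinearEquiv 2 ℂ K H).symm.toContinuousLinearMap ∘L
    ((U.symm.toContinuousLinearEquiv.toContinuousLinearMap ∘L R ∘L .snd ℂ K H).prod
      (-(R ∘L U.toContinuousLinearEquiv.toContinuousLinearMap ∘L .fst ℂ K H + F ∘L .snd ℂ K H))) ∘L
    (WithLp.prodContinuousLinearEquiv 2 ℂ K H).toContinuousLinearMap

variable (U : K ≃ₗᵢ[ℂ] H) (Q R F : H →L[ℂ] H) (x : WithLp 2 (K × H))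

theorem waveProjection_fst : (waveProjection U Q x).fst = U.symm (Q (U x.fst)) := rfl

theorem waveProjection_snd : (waveProjection U Q x).snd = Q x.snd := rfl

theorem waveOperator_fst : (waveOperator U R F x).fst = U.symm (R x.snd) := rfl

theorem waveOperator_snd : (waveOperator U R F x).snd = -(R (U x.fst) + F x.snd) := rfl

variable {U Q R F} {x}

theorem waveOperator_eq_waveProjection_iff {y : WithLp 2 (K × H)} :
    waveOperator U R F x = waveProjection U Q y ↔
      R x.snd = Q (U y.fst) ∧ R (U x.fst) + F x.snd = Q (-y.snd) := by
  rw [withLp_prod_ext_iff, waveOperator_fst, waveOperator_snd, waveProjection_fst,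
    waveProjection_snd, U.symm.injective.eq_iff, map_neg, neg_eq_iff_eq_neg]

theorem norm_waveProjection_apply_le (hQ : ∀ v, ‖Q v‖ ≤ ‖v‖) : ‖waveProjection U Q x‖ ≤ ‖x‖ := by
  refine le_of_sq_le_sq ?_ (norm_nonneg _)
  rw [WithLp.prod_norm_sq_eq_of_L2, WithLp.prod_norm_sq_eq_of_L2, waveProjection_fst,
    waveProjection_snd, U.symm.norm_map, ← U.norm_map x.fst]
  gcongr <;> exact hQ _

theorem tendsto_waveProjection {P : ℕ → H →L[ℂ] H}
    (hP : ∀ v, Tendsto (fun n => P n v) atTop (𝓝 v)) :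
    Tendsto (fun n => waveProjection U (P n) x) atTop (𝓝 x) := by
  have hfst := (U.symm.continuous.tendsto _).comp (hP (U x.fst))
  rw [U.symm_apply_apply] at hfst
  exact ((WithLp.prodContinuousLinearEquiv 2 ℂ K H).symm.continuous.tendsto _).comp
    (hfst.prodMk_nhds (hP x.snd))

theorem commute_waveProjection_waveOperator (hQR : Commute Q R) (hQF : Commute Q F) :
    Commute (waveProjection U Q) (waveOperator U R F) := by
  have QR (v : H) : Q (R v) = R (Q v) := DFunLike.congr_fun hQR.eq v
  have QF (v : H) : Q (F v) = F (Q v) := DFunLike.congr_fun hQF.eq v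
  ext x
  simp [withLp_prod_ext_iff, waveProjection_fst, waveProjection_snd, waveOperator_fst,
    waveOperator_snd, QR, QF]

theorem waveOperator_mul_waveProjection :
    waveOperator U R F * waveProjection U Q = waveOperator U (R * Q) (F * Q) := by
  ext x
  simp [withLp_prod_ext_iff, waveProjection_fst, waveProjection_snd, waveOperator_fst,
    waveOperator_snd]

theorem re_inner_waveOperator_le (hR : (R : H →ₗ[ℂ] H).IsSymmetric)
    (hF : ∀ v, 0 ≤ (inner ℂ v (F v)).re) : (inner ℂ x (waveOperator U R F x)).re ≤ 0 := by
  have inner_re : (inner ℂ x (waveOperator U R F x)).re =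
      (inner ℂ (U x.fst) (R x.snd)).re -
        ((inner ℂ x.snd (R (U x.fst))).re + (inner ℂ x.snd (F x.snd)).re) := by
    rw [WithLp.prod_inner_apply, Complex.add_re]
    change (inner ℂ x.fst (U.symm (R x.snd))).re +
      (inner ℂ x.snd (-(R (U x.fst) + F x.snd))).re = _
    rw [← U.inner_map_map, U.apply_symm_apply, inner_neg_right, inner_add_right, Complex.neg_re,
      Complex.add_re, sub_eq_add_neg]
  have skew : (inner ℂ (U x.fst) (R x.snd)).re = (inner ℂ x.snd (R (U x.fst))).re := by
    rw [← inner_conj_symm, Complex.conj_re]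
    exact congrArg _ (hR x.snd (U x.fst))
  rw [inner_re, skew]
  linarith [hF x.snd]

end Wave

namespace SpectralMeasure

variable {Ω : Type*} [MeasurableSpace Ω] {K H : Type*} [NormedAddCommGroup K]
  [InnerProductSpace ℂ K] [NormedAddCommGroup H] [InnerProductSpace ℂ H] [CompleteSpace H]

/-- The truncations of the wave operator `(u, v) ↦ (U⁻¹ (∫ φ dE) v, -((∫ φ dE) U u + (∫ ψ dE) v))`
to the spectral sets `ω n`, on which `φ` and `ψ` are bounded. -/
def waveTruncation (E : SpectralMeasure Ω H) (U : K ≃ₗᵢ[ℂ] H) {ω : ℕ → Set Ω}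
    (hω : IsExhaustion ω) {φ ψ : Ω → ℝ} (hφ : ∀ n, IsBoundedMeasurable ((ω n).indicator φ))
    (hψ : ∀ n, IsBoundedMeasurable ((ω n).indicator ψ)) (hψ_nonneg : ∀ s, 0 ≤ ψ s) :
    TruncatedGenerator (WithLp 2 (K × H)) where
  P n := waveProjection U (E.toFun (ω n))
  G n := waveOperator U (E.boundedIntegral ((ω n).indicator φ))
    (E.boundedIntegral ((ω n).indicator ψ))
  norm_P_le _ _ := norm_waveProjection_apply_le (E.norm_toFun_le _)
  tendsto_P _ := tendsto_waveProjection (tendsto_toFun hω E)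
  commute m n := commute_waveProjection_waveOperator
    (ContinuousLinearMap.ext (toFun_boundedIntegral_comm (hω.measurableSet m) (hφ n)))
    (ContinuousLinearMap.ext (toFun_boundedIntegral_comm (hω.measurableSet m) (hψ n)))
  G_mul_P m n hmn := by
    rw [waveOperator_mul_waveProjection]
    congr 1 <;> ext x
    · exact boundedIntegral_indicator_toFun (hω.measurableSet m) (hω.mono hmn) (hφ n) x
    · exact boundedIntegral_indicator_toFun (hω.measurableSet m) (hω.mono hmn) (hψ n) x
  dissipative n _ := by
    refine re_inner_waveOperator_le (fun v w => inner_boundedIntegral_left (hφ n) w v) fun v => ?_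
    rw [inner_boundedIntegral_self (hψ n), Complex.ofReal_re]
    exact integral_nonneg (Set.indicator_nonneg fun s _ => hψ_nonneg s)

end SpectralMeasure

namespace StrictlyPositiveOperator

variable {H : Type*} [NormedAddCommGroup H] [InnerProductSpace ℂ H] [CompleteSpace H]
  {A : StrictlyPositiveOperator H}

theorem measurable_sqrt_coe : Measurable fun s : A.spectrum => √(s : ℝ) :=
  Real.continuous_sqrt.measurable.comp measurable_subtype_coe

theorem measurable_damping (f : C(A.spectrum, ℝ≥0)) : Measurable fun s => (f s : ℝ) :=
  (NNReal.continuous_coe.comp f.continuous).measurable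

theorem isBoundedMeasurable_inv_sqrt :
    IsBoundedMeasurable fun s : A.spectrum => (√(s : ℝ))⁻¹ := by
  obtain ⟨C, hC⟩ := A.exists_inv_le
  refine ⟨measurable_sqrt_coe.inv, √C, fun s => ?_⟩
  rw [Real.norm_of_nonneg (by positivity), ← Real.sqrt_inv]
  exact Real.sqrt_le_sqrt (hC s s.2)

section Cutoff

/-- The part of the spectrum on which `s` and `f s` are at most `n`. -/
def cutoff (f : C(A.spectrum, ℝ≥0)) (n : ℕ) : Set A.spectrum := {s | (s : ℝ) ≤ n ∧ (f s : ℝ) ≤ n}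

variable (f : C(A.spectrum, ℝ≥0))

theorem isExhaustion_cutoff : IsExhaustion (cutoff f) where
  measurableSet n := (measurableSet_le measurable_subtype_coe measurable_const).inter
    (measurableSet_le (measurable_damping f) measurable_const)
  mono _ _ hmn _ hs := ⟨hs.1.trans (Nat.cast_le.2 hmn), hs.2.trans (Nat.cast_le.2 hmn)⟩
  iUnion := by
    refine Set.eq_univ_of_forall fun s => ?_
    obtain ⟨n, hn⟩ := exists_nat_ge (max (s : ℝ) (f s))
    exact Set.mem_iUnion.2 ⟨n, max_le_iff.1 hn⟩

variable (n : ℕ)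

theorem isBoundedMeasurable_cutoff_coe :
    IsBoundedMeasurable ((cutoff f n).indicator fun s => (s : ℝ)) :=
  .indicator_of_bound measurable_subtype_coe ((isExhaustion_cutoff f).measurableSet n)
    fun s hs => (Real.norm_of_nonneg (A.pos_of_mem_spectrum s.2).le).trans_le hs.1

theorem isBoundedMeasurable_cutoff_sqrt :
    IsBoundedMeasurable ((cutoff f n).indicator fun s => √(s : ℝ)) :=
  .indicator_of_bound measurable_sqrt_coe ((isExhaustion_cutoff f).measurableSet n)
    fun _ hs => (Real.norm_of_nonneg (Real.sqrt_nonneg _)).trans_le (Real.sqrt_le_sqrt hs.1)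

theorem isBoundedMeasurable_cutoff_damping :
    IsBoundedMeasurable ((cutoff f n).indicator fun s => (f s : ℝ)) :=
  .indicator_of_bound (measurable_damping f) ((isExhaustion_cutoff f).measurableSet n)
    fun _ hs => (Real.norm_of_nonneg (NNReal.coe_nonneg _)).trans_le hs.2

end Cutoff

theorem mem_graph_sqrtOp_iff {E : SpectralMeasure A.spectrum H} {v w : H} {a : H1 E}
    (hw : H1.sqrt E a = w) : (v, w) ∈ (sqrtOp E).graph ↔ H1.incl E a = v := by
  subst hw
  refine ⟨fun h => ?_, ?_⟩
  · obtain ⟨b, hb, hba⟩ := (LinearPMap.mem_graph_iff _).1 h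
    rwa [← H1.sqrt_injective E (a₁ := b) hba]
  · rintro rfl
    exact (sqrtOp E).mem_graph a

variable (E : SpectralMeasure A.spectrum H)

theorem H1.sqrt_surjective : Function.Surjective (H1.sqrt E) := by
  intro w
  have sqrt_mul_inv : (fun s : A.spectrum => √(s : ℝ)) * (fun s : A.spectrum => (√(s : ℝ))⁻¹) = 1 :=
    funext fun s => mul_inv_cancel₀ (Real.sqrt_pos.2 (A.pos_of_mem_spectrum s.2)).ne'
  have mem_graph := (SpectralMeasure.mem_integralGraph_iff_of_mul_eq_one (E := E)
    measurable_sqrt_coe isBoundedMeasurable_inv_sqrt sqrt_mul_inv _ w).2 rfl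
  rw [← SpectralMeasure.graph_integral, LinearPMap.mem_graph_iff] at mem_graph
  obtain ⟨u, -, hu⟩ := mem_graph
  exact ⟨u, hu⟩

/-- The isometric isomorphism `A^{1/2} : H¹ ≃ H`. -/
def H1.equiv : H1 E ≃ₗᵢ[ℂ] H :=
  LinearIsometryEquiv.ofSurjective ⟨H1.sqrt E, fun _ => rfl⟩ (H1.sqrt_surjective E)

instance : CompleteSpace (H1 E) :=
  (completeSpace_congr (e := (H1.equiv E).toEquiv) (H1.equiv E).isometry.isUniformEmbedding).2
    inferInstance

variable (f : C(A.spectrum, ℝ≥0))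

/-- The truncations of the operator `(u, v) ↦ (v, -(A u + f(A) v))`. -/
def truncatedGenerator : TruncatedGenerator (PhaseSpace E) :=
  E.waveTruncation (H1.equiv E) (isExhaustion_cutoff f) (isBoundedMeasurable_cutoff_sqrt f)
    (isBoundedMeasurable_cutoff_damping f) fun s => (f s).2

variable {E}

theorem incl_eq_iff (a : H1 E) (v : H) : H1.incl E a = v ↔
    ∀ n, E.boundedIntegral ((cutoff f n).indicator fun s => √(s : ℝ)) v =
      E.toFun (cutoff f n) (H1.sqrt E a) := by
  rw [← mem_graph_sqrtOp_iff rfl, sqrtOp, SpectralMeasure.graph_integral]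
  exact SpectralMeasure.mem_integralGraph_iff (isExhaustion_cutoff f) measurable_sqrt_coe
    (isBoundedMeasurable_cutoff_sqrt f) _ _

theorem boundedIntegral_sqrt_sqrt (u : H1 E) (n : ℕ) :
    E.boundedIntegral ((cutoff f n).indicator fun s => √(s : ℝ)) (H1.sqrt E u) =
      E.boundedIntegral ((cutoff f n).indicator fun s => (s : ℝ)) (H1.incl E u) := by
  have hm := (isExhaustion_cutoff f).measurableSet n
  have hb := isBoundedMeasurable_cutoff_sqrt f n
  have sqrt_mul_sqrt : (cutoff f n).indicator (fun s => √(s : ℝ)) *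
      (cutoff f n).indicator (fun s => √(s : ℝ)) = (cutoff f n).indicator fun s => (s : ℝ) := by
    ext s
    rw [Pi.mul_apply]
    by_cases hs : s ∈ cutoff f n
    · simp only [Set.indicator_of_mem hs, Real.mul_self_sqrt (A.pos_of_mem_spectrum s.2).le]
    · simp only [Set.indicator_of_notMem hs, zero_mul]
  rw [← sqrt_mul_sqrt, ← SpectralMeasure.boundedIntegral_boundedIntegral hb hb,
    (incl_eq_iff f u _).1 rfl, SpectralMeasure.boundedIntegral_indicator_toFun hm subset_rfl hb]

theorem dualSumEq_iff (hE : A.IsSpectralMeasure E) (u v k : H) :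
    DualSumEq E f u v k ↔
      ∀ n, E.boundedIntegral ((cutoff f n).indicator fun s => (s : ℝ)) u +
        E.boundedIntegral ((cutoff f n).indicator fun s => (f s : ℝ)) v =
          E.toFun (cutoff f n) k := by
  rw [← SpectralMeasure.forall_inner_add_inner_eq_iff (isExhaustion_cutoff f)
    measurable_subtype_coe (isBoundedMeasurable_cutoff_coe f) (measurable_damping f)
    (isBoundedMeasurable_cutoff_damping f), ← SpectralMeasure.graph_integral, ← hE,
    ← SpectralMeasure.graph_integral]
  constructor
  · intro h w p q hp hq
    obtain ⟨⟨_, hw⟩, rfl, rfl⟩ := (LinearPMap.mem_graph_iff _).1 hp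
    obtain ⟨⟨_, hw'⟩, rfl, rfl⟩ := (LinearPMap.mem_graph_iff _).1 hq
    exact h _ hw hw'
  · intro h w hw hw'
    exact h w _ _ (A.op.mem_graph ⟨w, hw⟩) ((damping E f).mem_graph ⟨w, hw'⟩)

theorem graph_generator_eq (hE : A.IsSpectralMeasure E) :
    (truncatedGenerator E f).semigroup.generator.graph = waveGraph E f := by
  ext p
  rw [ContractionSemigroup.graph_generator, TruncatedGenerator.mem_generatorGraph_iff,
    show p ∈ waveGraph E f ↔ H1.incl E p.2.fst = p.1.snd ∧
      DualSumEq E f (H1.incl E p.1.fst) p.1.snd (-p.2.snd) from Iff.rfl,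
    incl_eq_iff f, dualSumEq_iff f hE, ← forall_and]
  refine forall_congr' fun n => ?_
  rw [← boundedIntegral_sqrt_sqrt]
  exact waveOperator_eq_waveProjection_iff

end StrictlyPositiveOperator

end

theorem mainTheorem8 {H : Type*} [NormedAddCommGroup H] [InnerProductSpace ℂ H] [CompleteSpace H]
    (A : StrictlyPositiveOperator H) (f : C(A.spectrum, ℝ≥0)) :
    (∃ E : SpectralMeasure A.spectrum H, A.IsSpectralMeasure E) ∧
    ∀ E : SpectralMeasure A.spectrum H, A.IsSpectralMeasure E →
      ∃ S : ContractionSemigroup (StrictlyPositiveOperator.PhaseSpace E),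
        S.generator.graph = StrictlyPositiveOperator.waveGraph E f :=
  ⟨⟨A.spectralMeasure, A.isSpectralMeasure_spectralMeasure⟩, fun E hE =>
    ⟨(StrictlyPositiveOperator.truncatedGenerator E f).semigroup,
      StrictlyPositiveOperator.graph_generator_eq f hE⟩⟩
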